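/- Let $\mathcal H=\{z\in\mathbb C:\Im z>0\}$, let $v$ be the $SL_2(\mathbb R)$-invariant measure $dv=y^{-2}\,dx\,dy$ on $\mathcal H$, and let $\widetilde{SL}_2(\mathbb R)$ be the metaplectic group of pairs $\sigma=(g_\sigma,\eta_\sigma)$, where $g_\sigma=\begin{pmatrix}a&b\\c&d\end{pmatrix}\in SL_2(\mathbb R)$ and $\eta_\sigma:\mathcal H\to\mathbb C$ is holomorphic with $\eta_\sigma(z)^2=cz+d$, with multiplication $\sigma_1\sigma_2=(g_{\sigma_1}g_{\sigma_2},\ \eta_{\sigma_1}(g_{\sigma_2}.z)\eta_{\sigma_2}(z))$, with its usual Lie group topology, and acting on $\mathcal H$ by $\sigma.z=g_\sigma.z$. Put $(f|_m\sigma)(z)=f(\sigma.z)\,\eta_\sigma(z)^{-2m}$ for $f:\mathcal H\to\mathbb C$ and $m\in\frac12+\mathbb Z_{\ge0}$. For a discrete subgroup $\Gamma$, integrals over $\Gamma\backslash\mathcal H$ of $\Gamma$-invariant functions are integrals with respect to $v$ over a Borel set containing exactly one point of each $\Gamma$-orbit, and $Z(\Gamma)=\Gamma\cap Z(\widetilde{SL}_2(\mathbb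 R))$. Let $\chi_m$ be the character $\kappa_t\mapsto e^{-imt}$ of $K=\{\sigma:\sigma.i=i\}=\{\kappa_t:t\in\mathbb R\}$, where $\kappa_t$ has matrix $\begin{pmatrix}\cos t&-\sin t\\ \sin t&\cos t\end{pmatrix}$ and $\eta_{\kappa_t}(i)=e^{it/2}$; note that $Z(\widetilde{SL}_2(\mathbb R))\subseteq K$. **Theorem.** Let $\Gamma$ be a discrete subgroup of $\widetilde{SL}_2(\mathbb R)$, $\Lambda$ a subgroup of $\Gamma$, $\chi:\Gamma\to\mathbb C^\times$ a unitary character, and $m\in\frac12+\mathbb Z_{\ge0}$. Let $f:\mathcal H\to\mathbb C$ be a measurable function such that - (f1) $f|_m\lambda=\chi(\lambda)f$ for all $\lambda\in\Lambda$; - (f2) $\int_{\Lambda\backslash\mathcal H}|f(z)\Im(z)^{m/2}|\,dv(z)<\infty$. Assume that $\chi|_{Z(\Gamma)}=\chi_m|_{Z(\Gamma)}$, and suppose that there is a Borel set $S\subseteq\mathcal H$ such that - (S1) if $z_1,z_2\in S$ and $z_1\ne z_2$, then $\Gamma.z_1\ne\Gamma.z_2$; - (S2) writing $(\Lambda.S)^c=\mathcal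 H\setminus\Lambda.S$, $$\int_{\Lambda\backslash\Lambda.S}\|f(z)\Im(z)^{m/2}\|\,dv(z)>\int_{\Lambda\backslash(\Lambda.S)^c}\|f(z)\Im(z)^{m/2}\|\,dv(z)$$ for some measurable function $\|\cdot\|:\mathbb C\to\mathbb R_{\ge0}$ with $\|0\|=0$, $\|z\|=\||z|\|$ for all $z\in\mathbb C$, and $\left\|\sum_{n\ge1}z_n\right\|\le\sum_{n\ge1}\|z_n\|$ for every sequence $(z_n)$ in $\mathbb C$ with $\sum_n|z_n|<\infty$. Then the Poincaré series $P_{\Lambda\backslash\Gamma,\chi}f=\sum_{\gamma\in\Lambda\backslash\Gamma}\overline{\chi(\gamma)}\,f|_m\gamma$ converges absolutely almost everywhere on $\mathcal H$ and $$0<\int_{\Gamma\backslash\mathcal H}\left|(P_{\Lambda\backslash\Gamma,\chi}f)(z)\Im(z)^{m/2}\right|dv(z)<\infty .$$ In particular, $P_{\Lambda\backslash\Gamma,\chi}f$ is not zero almost everywhere. -/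

import Mathlib

open MeasureTheory UpperHalfPlane
open scoped MatrixGroups Manifold Topology ENNReal NNReal ComplexConjugate

noncomputable section

/-! ### The metaplectic cover of `SL(2, ℝ)` -/

/-- The metaplectic cover of `SL(2, ℝ)`: pairs `(g, η)` with `g ∈ SL(2, ℝ)` and `η : ℍ → ℂ`
holomorphic such that `η(z)² = c z + d` for all `z ∈ ℍ`. -/
@[ext]
structure Mp2 where
  /-- the projection to `SL(2, ℝ)` -/
  g : SL(2, ℝ)
  /-- the holomorphic square root of the factor of automorphy -/
  η : ℍ → ℂ
  holo : MDiff η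
  sq : ∀ z : ℍ, η z ^ 2 = (g 1 0 : ℂ) * z + (g 1 1 : ℂ)

namespace Mp2

theorem denom_SL (g : SL(2, ℝ)) (z : ℂ) :
    denom (g : GL (Fin 2) ℝ) z = (g 1 0 : ℂ) * z + (g 1 1 : ℂ) := rfl

theorem SL_smul_eq (g : SL(2, ℝ)) (z : ℍ) : g • z = (g : GL (Fin 2) ℝ) • z := rfl

theorem SL_det_pos (g : SL(2, ℝ)) : 0 < ((g : GL (Fin 2) ℝ)).det.val := by simp

theorem mdiff_smul (g : SL(2, ℝ)) : MDiff (fun z : ℍ => g • z) :=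
  mdifferentiable_smul (SL_det_pos g)

theorem denom_mul_SL (g h : SL(2, ℝ)) (z : ℍ) :
    ((g * h) 1 0 : ℂ) * z + ((g * h) 1 1 : ℂ)
      = ((g 1 0 : ℂ) * (h • z : ℍ) + (g 1 1 : ℂ)) * ((h 1 0 : ℂ) * z + (h 1 1 : ℂ)) := by
  have := denom_cocycle_σ (g : GL (Fin 2) ℝ) (h : GL (Fin 2) ℝ) z
  have hσ : σ (h : GL (Fin 2) ℝ) = .refl ℝ ℂ := by simp [σ]
  rw [hσ, ← map_mul] at this
  exact this

theorem η_ne_zero (a : Mp2) (z : ℍ) : a.η z ≠ 0 := by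
  intro h
  have h1 := a.sq z
  rw [h] at h1
  exact denom_ne_zero (a.g : GL (Fin 2) ℝ) z (by rw [denom_SL, ← h1]; simp)

instance : Mul Mp2 where
  mul a b :=
    { g := a.g * b.g
      η := fun z => a.η (b.g • z) * b.η z
      holo := (a.holo.comp (mdiff_smul b.g)).mul b.holo
      sq := fun z => by rw [mul_pow, a.sq, b.sq, denom_mul_SL] }

instance : One Mp2 where
  one :=
    { g := 1
      η := fun _ => 1
      holo := mdifferentiable_const
      sq := fun z => by simp }

instance : Inv Mp2 where
  inv a :=
    { g := a.g⁻¹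
      η := fun z => (a.η (a.g⁻¹ • z))⁻¹
      holo := by
        have h := a.holo.comp (mdiff_smul a.g⁻¹)
        rw [UpperHalfPlane.mdifferentiable_iff] at h ⊢
        exact h.inv fun z _ => a.η_ne_zero _
      sq := fun z => by
        have h := denom_mul_SL a.g a.g⁻¹ z
        have h0 : ((a.g 1 0 : ℂ) * (a.g⁻¹ • z : ℍ) + (a.g 1 1 : ℂ)) ≠ 0 := by
          rw [← a.sq]; exact pow_ne_zero _ (a.η_ne_zero _)
        rw [inv_pow, a.sq]
        rw [mul_inv_cancel] at h
        exact (eq_inv_of_mul_eq_one_right (by rw [← h]; simp)).symm }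

@[simp] theorem mul_g (a b : Mp2) : (a * b).g = a.g * b.g := rfl
@[simp] theorem mul_η (a b : Mp2) (z : ℍ) : (a * b).η z = a.η (b.g • z) * b.η z := rfl
@[simp] theorem one_g : (1 : Mp2).g = 1 := rfl
@[simp] theorem one_η (z : ℍ) : (1 : Mp2).η z = 1 := rfl
@[simp] theorem inv_g (a : Mp2) : (a⁻¹).g = a.g⁻¹ := rfl
@[simp] theorem inv_η (a : Mp2) (z : ℍ) : (a⁻¹).η z = (a.η (a.g⁻¹ • z))⁻¹ := rfl

instance : Group Mp2 where
  mul_assoc a b c := by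
    ext z
    · simp [mul_assoc]
    · simp [mul_assoc, mul_smul]
  one_mul a := by
    ext z <;> simp
  mul_one a := by
    ext z <;> simp
  inv_mul_cancel a := by
    ext z
    · simp
    · simp [a.η_ne_zero]

/-- The projection `P : Mp2 → SL(2, ℝ)`. -/
def proj : Mp2 →* SL(2, ℝ) where
  toFun := g
  map_one' := rfl
  map_mul' _ _ := rfl

/-- The action `σ.z = g_σ.z` on the upper half-plane. -/
instance : MulAction Mp2 ℍ := MulAction.compHom ℍ proj

theorem smul_def (a : Mp2) (z : ℍ) : a • z = a.g • z := rfl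

/-- The topology of `Mp2`, identifying `σ` with `(g_σ, η_σ(i)) ∈ SL(2, ℝ) × ℂ`. It is the topology
for which the Iwasawa parametrization is a local homeomorphism, see `isLocalHomeomorph_iwasawa`. -/
instance : TopologicalSpace Mp2 :=
  TopologicalSpace.induced (fun a : Mp2 => (a.g, a.η I)) inferInstance

/-- `n_x`. -/
def n (x : ℝ) : Mp2 where
  g := ⟨!![1, x; 0, 1], by simp⟩
  η := fun _ => 1
  holo := mdifferentiable_const
  sq := fun z => by simp

/-- `a_y`, for `y > 0`. -/
def a (y : {y : ℝ // 0 < y}) : Mp2 where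
  g := ⟨!![(y : ℝ) ^ (1 / 2 : ℝ), 0; 0, (y : ℝ) ^ (-(1 / 2) : ℝ)], by
    simp [← Real.rpow_add y.2]⟩
  η := fun _ => (((y : ℝ) ^ (-(1 / 4) : ℝ) : ℝ) : ℂ)
  holo := mdifferentiable_const
  sq := fun z => by
    have : ((y : ℝ) ^ (-(1 / 4) : ℝ)) ^ 2 = (y : ℝ) ^ (-(1 / 2) : ℝ) := by
      rw [← Real.rpow_natCast, ← Real.rpow_mul y.2.le]; norm_num
    rw [← Complex.ofReal_pow, this]
    simp

theorem kappa_slit (t : ℝ) (z : ℍ) :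
    (Real.sin t * (z : ℂ) + Real.cos t) * Complex.exp (-(t * Complex.I)) ∈ Complex.slitPlane := by
  rw [Complex.mem_slitPlane_iff_not_le_zero]
  intro h
  set w := (Real.sin t * (z : ℂ) + Real.cos t) * Complex.exp (-(t * Complex.I)) with hw
  obtain ⟨h1, h2⟩ := Complex.le_def.1 h
  have hw2 : Real.sin t * (z : ℂ) + Real.cos t = w * Complex.exp (t * Complex.I) := by
    rw [hw, mul_assoc, ← Complex.exp_add]; simp
  have him : w.im = 0 := by simpa using h2
  have hre : w.re ≤ 0 := by simpa using h1
  rw [Complex.exp_mul_I, ← Complex.ofReal_cos, ← Complex.ofReal_sin] at hw2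
  have e1 := congrArg Complex.im hw2
  have e2 := congrArg Complex.re hw2
  simp only [Complex.add_im, Complex.add_re, Complex.mul_im, Complex.mul_re, Complex.ofReal_re,
    Complex.ofReal_im, Complex.I_re, Complex.I_im, him, coe_im, coe_re] at e1 e2
  ring_nf at e1 e2
  have hz := z.im_pos
  have hs : Real.sin t = 0 := by
    have : Real.sin t * (z.im - w.re) = 0 := by linarith
    rcases mul_eq_zero.1 this with h | h
    · exact h
    · linarith
  have hc := Real.sin_sq_add_cos_sq t
  rw [hs] at e2 hc
  have : Real.cos t * (1 - w.re) = 0 := by linarith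
  rcases mul_eq_zero.1 this with h | h
  · rw [h] at hc; norm_num at hc
  · linarith

/-- `κ_t`, the element of `Mp2` with matrix `(cos t, -sin t; sin t, cos t)` and
`η(i) = e^{it/2}`. -/
def κ (t : ℝ) : Mp2 where
  g := ⟨!![Real.cos t, -Real.sin t; Real.sin t, Real.cos t], by
    rw [Matrix.det_fin_two_of]; linarith [Real.sin_sq_add_cos_sq t]⟩
  η := fun z => Complex.exp (t / 2 * Complex.I) *
    ((Real.sin t * (z : ℂ) + Real.cos t) * Complex.exp (-(t * Complex.I))) ^ (1 / 2 : ℂ)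
  holo := by
    rw [UpperHalfPlane.mdifferentiable_iff]
    intro z hz
    have h : DifferentiableAt ℂ (fun z : ℂ => Complex.exp (t / 2 * Complex.I) *
        ((Real.sin t * z + Real.cos t) * Complex.exp (-(t * Complex.I))) ^ (1 / 2 : ℂ)) z := by
      refine DifferentiableAt.const_mul (DifferentiableAt.cpow_const (by fun_prop) ?_) _
      exact kappa_slit t ⟨z, hz⟩
    refine (h.congr_of_eventuallyEq ?_).differentiableWithinAt
    filter_upwards [isOpen_upperHalfPlaneSet.mem_nhds hz] with w hw
    simp [ofComplex_apply_of_im_pos hw]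
  sq := fun z => by
    rw [mul_pow, ← Complex.exp_nat_mul, ← Complex.cpow_nat_mul]
    simp only [Nat.cast_ofNat]
    rw [show (2 : ℂ) * (1 / 2) = 1 by norm_num, Complex.cpow_one, mul_comm, mul_assoc,
      ← Complex.exp_add]
    rw [show -(t * Complex.I) + 2 * (t / 2 * Complex.I) = (0 : ℂ) by ring]
    simp

theorem κ_η_I (t : ℝ) : (κ t).η I = Complex.exp (t / 2 * Complex.I) := by
  have h : (Real.sin t * ((I : ℍ) : ℂ) + Real.cos t) * Complex.exp (-(t * Complex.I)) = 1 := by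
    have : (Real.sin t * ((I : ℍ) : ℂ) + Real.cos t) = Complex.exp (t * Complex.I) := by
      rw [Complex.exp_mul_I, Complex.ofReal_cos, Complex.ofReal_sin, coe_I]; ring
    rw [this, ← Complex.exp_add]; simp
  change _ * _ = _
  rw [h]; simp

/-- The Iwasawa parametrization `(x, y, t) ↦ n_x a_y κ_t`. -/
def iwasawa (p : ℝ × {y : ℝ // 0 < y} × ℝ) : Mp2 := n p.1 * a p.2.1 * κ p.2.2

theorem n_smul (x : ℝ) (z : ℍ) : ((n x • z : ℍ) : ℂ) = z + x := by
  rw [smul_def, coe_specialLinearGroup_apply]; simp [n]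

theorem a_smul (y : {y : ℝ // 0 < y}) (z : ℍ) : ((a y • z : ℍ) : ℂ) = (y : ℝ) * z := by
  have h : (y : ℝ) ^ (1 / 2 : ℝ) = y * (y : ℝ) ^ (-(1 / 2) : ℝ) := by
    nth_rewrite 2 [← Real.rpow_one (y : ℝ)]
    rw [← Real.rpow_add y.2]; norm_num
  have h0 : (((y : ℝ) ^ (-(1 / 2) : ℝ) : ℝ) : ℂ) ≠ 0 := by
    exact_mod_cast (Real.rpow_pos_of_pos y.2 _).ne'
  rw [smul_def, coe_specialLinearGroup_apply]
  simp only [a, Matrix.SpecialLinearGroup.coe_mk, Matrix.of_apply, Matrix.cons_val_zero,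
    Matrix.cons_val_one, Matrix.cons_val', Matrix.cons_val_fin_one, Algebra.algebraMap_self_apply]
  rw [h]
  generalize (y : ℝ) ^ (-(1 / 2) : ℝ) = r at h0 ⊢
  push_cast
  simp only [zero_mul, zero_add, add_zero]
  field_simp

theorem κ_smul_I (t : ℝ) : κ t • I = I := by
  ext1
  have h0 : (Real.sin t : ℂ) * Complex.I + Real.cos t ≠ 0 := by
    have : (Real.sin t : ℂ) * Complex.I + Real.cos t = Complex.exp (t * Complex.I) := by
      rw [Complex.exp_mul_I, Complex.ofReal_cos, Complex.ofReal_sin]; ring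
    rw [this]; exact Complex.exp_ne_zero _
  rw [smul_def, coe_specialLinearGroup_apply]
  simp only [κ, Matrix.SpecialLinearGroup.coe_mk, Matrix.of_apply, Matrix.cons_val_zero,
    Matrix.cons_val_one, Matrix.cons_val', Matrix.cons_val_fin_one, Algebra.algebraMap_self_apply,
    coe_I]
  rw [div_eq_iff h0]
  push_cast
  linear_combination (-(Complex.sin t)) * Complex.I_sq

/-- An element of `Mp2` is determined by `σ.i` and `η_σ(i)`. -/
theorem eq_of_I {s t : Mp2} (h1 : s • I = t • I) (h2 : s.η I = t.η I) : s = t := by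
  have hd : (s.g 1 0 : ℂ) * (I : ℍ) + (s.g 1 1 : ℂ) = (t.g 1 0 : ℂ) * (I : ℍ) + (t.g 1 1 : ℂ) := by
    rw [← s.sq, ← t.sq, h2]
  have hd0 : (t.g 1 0 : ℂ) * (I : ℍ) + (t.g 1 1 : ℂ) ≠ 0 := by
    rw [← t.sq]; exact pow_ne_zero _ (t.η_ne_zero _)
  have hn : (s.g 0 0 : ℂ) * (I : ℍ) + (s.g 0 1 : ℂ) = (t.g 0 0 : ℂ) * (I : ℍ) + (t.g 0 1 : ℂ) := by
    have := congrArg UpperHalfPlane.coe h1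
    rw [smul_def, smul_def, coe_specialLinearGroup_apply, coe_specialLinearGroup_apply] at this
    simp only [Algebra.algebraMap_self_apply] at this
    rw [hd, div_left_inj' hd0] at this
    exact this
  have hg : s.g = t.g := by
    have e1 := congrArg Complex.re hd
    have e2 := congrArg Complex.im hd
    have e3 := congrArg Complex.re hn
    have e4 := congrArg Complex.im hn
    simp at e1 e2 e3 e4
    ext i j
    fin_cases i <;> fin_cases j <;> simpa
  have hη : Set.EqOn s.η t.η Set.univ := by
    refine isPreconnected_univ.eq_of_sq_eq s.holo.continuous.continuousOn
      t.holo.continuous.continuousOn (fun z _ => ?_) (fun {z} _ => t.η_ne_zero z)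
      (Set.mem_univ I) h2
    simp only [Pi.pow_apply]
    rw [s.sq, t.sq, hg]
  exact Mp2.ext hg (funext fun z => hη (Set.mem_univ z))

theorem iwasawa_smul_I (p : ℝ × {y : ℝ // 0 < y} × ℝ) :
    ((iwasawa p • I : ℍ) : ℂ) = p.1 + p.2.1 * Complex.I := by
  rw [iwasawa, mul_smul, mul_smul, κ_smul_I, n_smul, a_smul, coe_I, add_comm]

theorem iwasawa_η_I (p : ℝ × {y : ℝ // 0 < y} × ℝ) :
    (iwasawa p).η I
      = (((p.2.1 : ℝ) ^ (-(1 / 4) : ℝ) : ℝ) : ℂ) * Complex.exp (p.2.2 / 2 * Complex.I) := by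
  rw [iwasawa, mul_η, κ_η_I]
  simp [n, a]

theorem norm_η_I (s : Mp2) : ‖s.η I‖ = (s • I).im ^ (-(1 / 4) : ℝ) := by
  have h1 : (s • I).im = (‖s.η I‖ ^ 4)⁻¹ := by
    rw [smul_def, SL_smul_eq, im_smul_eq_div_normSq, denom_SL, ← s.sq, Complex.normSq_eq_norm_sq,
      norm_pow, ← pow_mul]
    simp
  rw [h1, Real.inv_rpow (by positivity), Real.rpow_neg (by positivity), inv_inv,
    ← Real.rpow_natCast, ← Real.rpow_mul (norm_nonneg _)]
  norm_num

theorem continuous_g : Continuous g :=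
  continuous_fst.comp (continuous_induced_dom (f := fun s : Mp2 => (s.g, s.η I)))

theorem continuous_η_I : Continuous fun s : Mp2 => s.η I :=
  continuous_snd.comp (continuous_induced_dom (f := fun s : Mp2 => (s.g, s.η I)))

theorem continuous_iwasawa : Continuous iwasawa := by
  rw [continuous_induced_rng]
  refine Continuous.prodMk ?_ ?_
  · change Continuous fun p : ℝ × {y : ℝ // 0 < y} × ℝ => (n p.1).g * (a p.2.1).g * (κ p.2.2).g
    refine (Continuous.mul ?_ ?_).mul ?_
    · refine Continuous.subtype_mk ?_ _
      refine continuous_matrix fun i j => ?_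
      fin_cases i <;> fin_cases j <;> simp <;> fun_prop
    · refine Continuous.subtype_mk ?_ _
      have h (r : ℝ) : Continuous fun p : ℝ × {y : ℝ // 0 < y} × ℝ => (p.2.1 : ℝ) ^ r :=
        Continuous.rpow_const (by fun_prop) fun p => Or.inl p.2.1.2.ne'
      refine continuous_matrix fun i j => ?_
      fin_cases i <;> fin_cases j <;> simp <;> first | exact continuous_const | skip
      · simpa using h (1 / 2)
      · simpa using h (-(1 / 2))
    · refine Continuous.subtype_mk ?_ _
      refine continuous_matrix fun i j => ?_
      fin_cases i <;> fin_cases j <;> simp <;> fun_prop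
  · have h (r : ℝ) : Continuous fun p : ℝ × {y : ℝ // 0 < y} × ℝ => (p.2.1 : ℝ) ^ r :=
      Continuous.rpow_const (by fun_prop) fun p => Or.inl p.2.1.2.ne'
    have : (fun p => (iwasawa p).η I) = fun p : ℝ × {y : ℝ // 0 < y} × ℝ =>
        (((p.2.1 : ℝ) ^ (-(1 / 4) : ℝ) : ℝ) : ℂ) * Complex.exp (p.2.2 / 2 * Complex.I) :=
      funext iwasawa_η_I
    change Continuous fun p => (iwasawa p).η I
    rw [this]
    exact (Complex.continuous_ofReal.comp (h _)).mul (by fun_prop)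

/-- The Iwasawa parametrization is a local homeomorphism for the topology of `Mp2`. -/
theorem isLocalHomeomorph_iwasawa : IsLocalHomeomorph iwasawa := by
  intro p₀
  set t₀ := p₀.2.2
  let u : Mp2 → ℂ := fun s => s.η I * Complex.exp (-(t₀ / 2 * Complex.I))
  have hu : Continuous u := continuous_η_I.mul continuous_const
  have hI : Continuous fun s : Mp2 => s • I :=
    (continuous_g.smul continuous_const : Continuous fun s : Mp2 => s.g • I)
  have hup (p : ℝ × {y : ℝ // 0 < y} × ℝ) : u (iwasawa p)
      = (((p.2.1 : ℝ) ^ (-(1 / 4) : ℝ) : ℝ) : ℂ) *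
        (Complex.cos (((p.2.2 - t₀) / 2 : ℝ)) + Complex.sin (((p.2.2 - t₀) / 2 : ℝ)) * Complex.I) := by
    simp only [u]
    rw [iwasawa_η_I, mul_assoc, ← Complex.exp_add, ← Complex.exp_mul_I]
    push_cast
    ring_nf
  have hpos (y : {y : ℝ // 0 < y}) : 0 < (y : ℝ) ^ (-(1 / 4) : ℝ) := Real.rpow_pos_of_pos y.2 _
  refine ⟨{ toFun := iwasawa
            invFun := fun s => ((s • I).re, ⟨(s • I).im, (s • I).im_pos⟩, t₀ + 2 * (u s).arg)
            source := {p | |p.2.2 - t₀| < Real.pi}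
            target := {s | 0 < (u s).re}
            map_source' := ?_
            map_target' := ?_
            left_inv' := ?_
            right_inv' := ?_
            open_source := ?_
            open_target := ?_
            continuousOn_toFun := continuous_iwasawa.continuousOn
            continuousOn_invFun := ?_ }, ?_, rfl⟩
  · intro p hp
    have hp' : |p.2.2 - t₀| < Real.pi := hp
    rw [abs_lt] at hp'
    have : 0 < Real.cos ((p.2.2 - t₀) / 2) :=
      Real.cos_pos_of_mem_Ioo ⟨by linarith [hp'.1], by linarith [hp'.2]⟩
    change 0 < (u (iwasawa p)).re
    rw [hup, ← Complex.ofReal_cos, ← Complex.ofReal_sin]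
    rw [Complex.re_ofReal_mul]
    simpa [-Complex.ofReal_cos, -Complex.ofReal_sin, -Complex.ofReal_div] using
      mul_pos (hpos p.2.1) this
  · intro s hs
    have hs' : 0 < (u s).re := hs
    have := Complex.abs_arg_lt_pi_div_two_iff.2 (Or.inl hs')
    change |t₀ + 2 * (u s).arg - t₀| < Real.pi
    rw [add_sub_cancel_left, abs_mul]
    norm_num
    linarith
  · intro p hp
    have hp' : |p.2.2 - t₀| < Real.pi := hp
    rw [abs_lt] at hp'
    have h1 := iwasawa_smul_I p
    have hre : (iwasawa p • I).re = p.1 := by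
      rw [← coe_re, h1]; simp
    have him : (iwasawa p • I).im = p.2.1 := by
      rw [← coe_im, h1]; simp
    have harg : (u (iwasawa p)).arg = (p.2.2 - t₀) / 2 := by
      rw [hup]
      exact Complex.arg_mul_cos_add_sin_mul_I (hpos _)
        ⟨by linarith [hp'.1, Real.pi_pos], by linarith [hp'.2, Real.pi_pos]⟩
    ext
    · exact hre
    · exact him
    · change t₀ + 2 * (u (iwasawa p)).arg = p.2.2
      rw [harg]; ring
  · intro s _
    refine eq_of_I ?_ ?_
    · ext1
      rw [iwasawa_smul_I]
      simp [Complex.ext_iff]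
    · rw [iwasawa_η_I]
      change (((s • I).im ^ (-(1 / 4) : ℝ) : ℝ) : ℂ) * _ = _
      rw [← norm_η_I]
      have hn : ‖u s‖ = ‖s.η I‖ := by
        have := Complex.norm_exp_ofReal_mul_I (-(t₀ / 2))
        simp only [u, norm_mul]
        rw [show (-(t₀ / 2 * Complex.I) : ℂ) = ((-(t₀ / 2) : ℝ) : ℂ) * Complex.I by push_cast; ring,
          this, mul_one]
      have hp := Complex.norm_mul_exp_arg_mul_I (u s)
      rw [hn] at hp
      have : Complex.exp (((t₀ + 2 * (u s).arg : ℝ) : ℂ) / 2 * Complex.I)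
          = Complex.exp ((u s).arg * Complex.I) * Complex.exp (t₀ / 2 * Complex.I) := by
        rw [← Complex.exp_add]; push_cast; ring_nf
      change _ * Complex.exp (((t₀ + 2 * (u s).arg : ℝ) : ℂ) / 2 * Complex.I) = _
      rw [this, ← mul_assoc, hp]
      simp only [u]
      rw [mul_assoc, ← Complex.exp_add]
      simp
  · have harg : ContinuousOn (fun s => (u s).arg) {s | 0 < (u s).re} := fun s hs =>
      ((Complex.continuousAt_arg (Or.inl hs)).comp hu.continuousAt).continuousWithinAt
    refine ContinuousOn.prodMk (continuous_re.comp hI).continuousOn (ContinuousOn.prodMk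
      (Continuous.subtype_mk (continuous_im.comp hI) _).continuousOn ?_)
    exact continuousOn_const.add (continuousOn_const.mul harg)
  · exact isOpen_lt (by fun_prop) continuous_const
  · exact isOpen_lt continuous_const (Complex.continuous_re.comp hu)
  · change |p₀.2.2 - t₀| < Real.pi
    simpa [t₀] using Real.pi_pos

/-- The stabilizer `K` of `i` consists of the elements `κ_t`. -/
theorem smul_I_eq_iff (s : Mp2) : s • I = I ↔ ∃ t : ℝ, s = κ t := by
  refine ⟨fun h => ⟨2 * (s.η I).arg, eq_of_I (by rw [h, κ_smul_I]) ?_⟩, ?_⟩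
  · have hn : ‖s.η I‖ = 1 := by rw [norm_η_I, h]; simp
    have hp := Complex.norm_mul_exp_arg_mul_I (s.η I)
    rw [hn] at hp
    rw [Complex.ofReal_one, one_mul] at hp
    rw [κ_η_I]
    push_cast
    rw [mul_div_cancel_left₀ _ two_ne_zero]
    exact hp.symm
  · rintro ⟨t, rfl⟩
    exact κ_smul_I t

/-! ### Weight `m = k + 1/2` -/

/-- The weight `m = 1/2 + k`, so that `2m = 2k + 1`. -/
def weight (k : ℕ) : ℝ := 1 / 2 + k

/-- The function `σ ↦ η_σ(i)^{-2m}`, `m = 1/2 + k`; on `K` it is the character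
`χ_m(κ_t) = e^{-imt}`, see `chiK_κ`. -/
def chiK (k : ℕ) (s : Mp2) : ℂ := s.η I ^ (-(2 * k + 1) : ℤ)

theorem chiK_κ (k : ℕ) (t : ℝ) :
    chiK k (κ t) = Complex.exp (-(Complex.I * weight k * t)) := by
  rw [chiK, κ_η_I, ← Complex.exp_int_mul, weight]
  congr 1
  push_cast
  ring

/-- The weight `m = 1/2 + k` action `(f|_m σ)(z) = f(σ.z) η_σ(z)^{-2m}`. -/
def slash (k : ℕ) (f : ℍ → ℂ) (s : Mp2) (z : ℍ) : ℂ := f (s • z) * s.η z ^ (-(2 * k + 1) : ℤ)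

/-- The function `z ↦ f(z) Im(z)^{m/2}`, `m = 1/2 + k`. -/
def weighted (k : ℕ) (f : ℍ → ℂ) (z : ℍ) : ℂ := f z * ((z.im ^ (weight k / 2) : ℝ) : ℂ)

/-- The term `conj χ(γ) (f|_m γ)(z)` of the Poincaré series attached to the coset `Λγ ∈ Λ\Γ`. When
`f|_m λ = χ(λ) f` for `λ ∈ Λ`, it does not depend on the representative `γ`. -/
def poincareTerm {Γ : Subgroup Mp2} (Λ : Subgroup Γ) (χ : Γ →* Circle) (k : ℕ) (f : ℍ → ℂ)
    (z : ℍ) (q : Quotient (QuotientGroup.rightRel Λ)) : ℂ :=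
  conj (χ q.out : ℂ) * slash k f (q.out : Γ) z

/-- The Poincaré series `P_{Λ\Γ,χ} f = ∑_{γ ∈ Λ\Γ} conj χ(γ) f|_m γ`, `m = 1/2 + k`. -/
def poincare {Γ : Subgroup Mp2} (Λ : Subgroup Γ) (χ : Γ →* Circle) (k : ℕ) (f : ℍ → ℂ)
    (z : ℍ) : ℂ :=
  ∑' q : Quotient (QuotientGroup.rightRel Λ), poincareTerm Λ χ k f z q

end Mp2

/-! ### Integration over a space of orbits -/

section OrbitMeasure

variable (G : Type*) {X : Type*} [Group G] [MulAction G X]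

/-- The projection `X → G\X`. -/
def orbitMk (x : X) : MulAction.orbitRel.Quotient G X := Quotient.mk _ x

theorem orbitMk_eq_iff {x y : X} : orbitMk G x = orbitMk G y ↔ ∃ g : G, g • y = x :=
  Quotient.eq

variable [MeasurableSpace X]

theorem measurable_orbitMk : Measurable (orbitMk G : X → MulAction.orbitRel.Quotient G X) :=
  measurable_quotient_mk''

/-- The measure induced by `μ` on the orbit space `G\X`: the measure of `A ⊆ G\X` is the largest
`μ`-measure of a measurable set of pairwise `G`-inequivalent points whose orbits lie in `A`. If `F`
is a measurable set that contains exactly one point of each orbit, it is `μ` restricted to `F`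
and carried to `G\X`, see `orbitMeasure_eq`. -/
def orbitMeasure (μ : Measure X) : Measure (MulAction.orbitRel.Quotient G X) :=
  Measure.ofMeasurable
    (fun A _ => ⨆ B : {B : Set X // MeasurableSet B ∧ B ⊆ orbitMk G ⁻¹' A ∧
      Set.InjOn (orbitMk G) B}, μ B)
    (by
      refine le_antisymm (iSup_le ?_) bot_le
      rintro ⟨B, -, hB, -⟩
      have : B = ∅ := by
        rw [Set.preimage_empty] at hB
        exact Set.subset_empty_iff.1 hB
      simp [this])
    (by
      intro A hA hd
      apply le_antisymm
      · refine iSup_le ?_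
        rintro ⟨B, hBm, hBA, hBi⟩
        have hB : B = ⋃ i, B ∩ orbitMk G ⁻¹' A i := by
          rw [← Set.inter_iUnion, ← Set.preimage_iUnion, Set.inter_eq_left.2 hBA]
        change μ B ≤ _
        rw [hB]
        refine (measure_iUnion_le _).trans (ENNReal.tsum_le_tsum fun i => ?_)
        exact le_iSup (fun B : {B : Set X // MeasurableSet B ∧ B ⊆ orbitMk G ⁻¹' A i ∧
          Set.InjOn (orbitMk G) B} => μ B) ⟨B ∩ orbitMk G ⁻¹' A i,
            hBm.inter (measurable_orbitMk G (hA i)), Set.inter_subset_right,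
            hBi.mono Set.inter_subset_left⟩
      · rw [ENNReal.tsum_eq_iSup_sum]
        refine iSup_le fun s => ?_
        let T (i : ℕ) := {B : Set X // MeasurableSet B ∧ B ⊆ orbitMk G ⁻¹' A i ∧
          Set.InjOn (orbitMk G) B}
        have : ∀ i, Nonempty (T i) := fun i => ⟨⟨∅, by simp⟩⟩
        have h1 (i : ℕ) : ⨆ B : T i, μ B = ⨆ b : (∀ j, T j), μ (b i) :=
          ((Function.surjective_eval i).iSup_comp (fun B : T i => μ B)).symm
        calc ∑ i ∈ s, ⨆ B : T i, μ B = ∑ i ∈ s, ⨆ b : (∀ j, T j), μ (b i) := by simp only [h1]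
          _ = ⨆ b : (∀ j, T j), ∑ i ∈ s, μ (b i) := by
            refine ENNReal.finsetSum_iSup fun b c => ?_
            refine ⟨fun j => if μ (b j) ≤ μ (c j) then c j else b j, fun j => ?_⟩
            by_cases h : μ (b j) ≤ μ (c j)
            · simp [h]
            · simp [h, (not_le.1 h).le]
          _ ≤ _ := by
            refine iSup_le fun b => ?_
            have hdisj : Set.PairwiseDisjoint (s : Set ℕ) fun i => (b i : Set X) := by
              intro i _ j _ hij
              exact ((hd hij).preimage (orbitMk G)).mono (b i).2.2.1 (b j).2.2.1
            rw [← measure_biUnion_finset hdisj fun i _ => (b i).2.1]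
            refine le_iSup (fun B : {B : Set X // MeasurableSet B ∧ B ⊆ orbitMk G ⁻¹' (⋃ i, A i) ∧
              Set.InjOn (orbitMk G) B} => μ B) ⟨⋃ i ∈ s, (b i : Set X), ?_, ?_, ?_⟩
            · exact s.measurableSet_biUnion fun i _ => (b i).2.1
            · refine Set.iUnion₂_subset fun i _ => (b i).2.2.1.trans ?_
              exact Set.preimage_mono (Set.subset_iUnion A i)
            · intro x hx y hy hxy
              obtain ⟨i, -, hi⟩ := Set.mem_iUnion₂.1 hx
              obtain ⟨j, -, hj⟩ := Set.mem_iUnion₂.1 hy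
              have hij : i = j := by
                by_contra hne
                refine Set.disjoint_left.1 (hd hne) ((b i).2.2.1 hi) ?_
                rw [hxy]
                exact (b j).2.2.1 hj
              subst hij
              exact (b i).2.2.2 hi hj hxy)

theorem orbitMeasure_apply (μ : Measure X) {A : Set (MulAction.orbitRel.Quotient G X)}
    (hA : MeasurableSet A) :
    orbitMeasure G μ A = ⨆ B : {B : Set X // MeasurableSet B ∧ B ⊆ orbitMk G ⁻¹' A ∧
      Set.InjOn (orbitMk G) B}, μ B :=
  Measure.ofMeasurable_apply A hA

theorem orbitMeasure_eq [Countable G] [MeasurableConstSMul G X] (μ : Measure X)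
    [SMulInvariantMeasure G X μ] {F : Set X} (hF : MeasurableSet F)
    (hinj : Set.InjOn (orbitMk G) F) (hsurj : ∀ x : X, ∃ g : G, g • x ∈ F) :
    orbitMeasure G μ = (μ.restrict F).map (orbitMk G) := by
  ext A hA
  have hA' := measurable_orbitMk G hA
  rw [orbitMeasure_apply G μ hA, Measure.map_apply (measurable_orbitMk G) hA,
    Measure.restrict_apply hA']
  apply le_antisymm
  · refine iSup_le ?_
    rintro ⟨B, hBm, hBA, hBi⟩
    obtain ⟨e, he⟩ := exists_surjective_nat G
    let C (i : ℕ) : Set X := B ∩ (e i • ·) ⁻¹' F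
    have hC (i : ℕ) : MeasurableSet (C i) := hBm.inter (measurable_const_smul (e i) hF)
    let D : ℕ → Set X := disjointed C
    have hDC (i : ℕ) : D i ⊆ C i := disjointed_subset C i
    have hD (i : ℕ) : MeasurableSet (D i) := MeasurableSet.disjointed hC i
    have hBD : B = ⋃ i, D i := by
      rw [iUnion_disjointed]
      refine Set.Subset.antisymm (fun x hx => ?_) (Set.iUnion_subset fun i => Set.inter_subset_left)
      obtain ⟨g, hg⟩ := hsurj x
      obtain ⟨i, rfl⟩ := he g
      exact Set.mem_iUnion.2 ⟨i, hx, hg⟩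
    have hE (i : ℕ) : MeasurableSet ((fun x => (e i)⁻¹ • x) ⁻¹' D i) :=
      measurable_const_smul (e i)⁻¹ (hD i)
    have key (i : ℕ) (x : X) (hx : (e i)⁻¹ • x ∈ D i) :
        x ∈ F ∧ orbitMk G ((e i)⁻¹ • x) = orbitMk G x := by
      refine ⟨?_, (orbitMk_eq_iff G).2 ⟨(e i)⁻¹, rfl⟩⟩
      have := (hDC i hx).2
      simpa using this
    change μ B ≤ _
    calc μ B = ∑' i, μ (D i) := by
          conv_lhs => rw [hBD]
          exact measure_iUnion (disjoint_disjointed C) hD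
      _ = ∑' i, μ ((fun x => (e i)⁻¹ • x) ⁻¹' D i) := by
          refine tsum_congr fun i => ?_
          exact (SMulInvariantMeasure.measure_preimage_smul (e i)⁻¹ (hD i)).symm
      _ = μ (⋃ i, (fun x => (e i)⁻¹ • x) ⁻¹' D i) := by
          refine (measure_iUnion (fun i j hij => ?_) hE).symm
          refine Set.disjoint_left.2 fun x hx hy => ?_
          have h1 := key i x hx
          have h2 := key j x hy
          have h3 := hBi (hDC i hx).1 (hDC j hy).1 (h1.2.trans h2.2.symm)
          refine Set.disjoint_left.1 (disjoint_disjointed C hij) hx ?_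
          change (e i)⁻¹ • x = (e j)⁻¹ • x at h3
          change (e i)⁻¹ • x ∈ D j
          rw [h3]
          exact hy
      _ ≤ _ := by
          refine measure_mono (Set.iUnion_subset fun i x hx => ⟨?_, (key i x hx).1⟩)
          have := hBA (hDC i hx).1
          rw [Set.mem_preimage, (key i x hx).2] at this
          exact this
  · exact le_iSup (fun B : {B : Set X // MeasurableSet B ∧ B ⊆ orbitMk G ⁻¹' A ∧
      Set.InjOn (orbitMk G) B} => μ B) ⟨orbitMk G ⁻¹' A ∩ F, hA'.inter hF, Set.inter_subset_left,
        hinj.mono Set.inter_subset_right⟩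

/-- The integral `∫_{G\A} φ dμ` for a `G`-invariant set `A ⊆ X` and a `G`-invariant function
`φ : X → [0, ∞]`. By invariance, the value of `φ` on an orbit can be taken at any of its points. -/
def orbitLIntegral (μ : Measure X) (A : Set X) (φ : X → ℝ≥0∞) : ℝ≥0∞ :=
  ∫⁻ q in orbitMk G '' A, φ q.out ∂(orbitMeasure G μ)

/-- The integral over `G\A` can be computed on any measurable set `F` that contains exactly one
point of each orbit. -/
theorem orbitLIntegral_eq [Countable G] [MeasurableConstSMul G X] (μ : Measure X)
    [SMulInvariantMeasure G X μ] {F : Set X} (hF : MeasurableSet F)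
    (hinj : Set.InjOn (orbitMk G) F) (hsurj : ∀ x : X, ∃ g : G, g • x ∈ F)
    {A : Set X} (hA : MeasurableSet A) (hAG : ∀ (g : G), ∀ x ∈ A, g • x ∈ A)
    {φ : X → ℝ≥0∞} (hφ : Measurable φ) (hφG : ∀ (g : G) (x : X), φ (g • x) = φ x) :
    orbitLIntegral G μ A φ = ∫⁻ x in F ∩ A, φ x ∂μ := by
  have hpre : orbitMk G ⁻¹' (orbitMk G '' A) = A := by
    refine Set.Subset.antisymm ?_ (Set.subset_preimage_image _ _)
    rintro x ⟨y, hy, hyx⟩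
    obtain ⟨g, rfl⟩ := (orbitMk_eq_iff G).1 hyx.symm
    exact hAG g y hy
  have hmk : MeasurableSet (orbitMk G '' A) := by
    change MeasurableSet (orbitMk G ⁻¹' (orbitMk G '' A))
    rwa [hpre]
  have hout (x : X) : φ (orbitMk G x).out = φ x := by
    obtain ⟨g, hg⟩ := (orbitMk_eq_iff G).1 (Quotient.out_eq (orbitMk G x))
    rw [← hg, hφG]
  have hφm : Measurable fun q : MulAction.orbitRel.Quotient G X => φ q.out := by
    intro S hS
    change MeasurableSet (orbitMk G ⁻¹' _)
    have : orbitMk G ⁻¹' ((fun q : MulAction.orbitRel.Quotient G X => φ q.out) ⁻¹' S)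
        = φ ⁻¹' S := by
      ext x; simp only [Set.mem_preimage, hout]
    rw [this]
    exact hφ hS
  rw [orbitLIntegral, orbitMeasure_eq G μ hF hinj hsurj,
    setLIntegral_map hmk hφm (measurable_orbitMk G), hpre, Measure.restrict_restrict hA,
    Set.inter_comm]
  simp only [hout]

/-- The set `G.S = {g.s : g ∈ G, s ∈ S}`. -/
def orbitSet (S : Set X) : Set X := {x | ∃ g : G, ∃ s ∈ S, g • s = x}

end OrbitMeasure

end

/-!
Suppose that the Poincaré series `P f` vanishes almost everywhere. Its terms have absolute value
`|f(γ.z) Im(γ.z)^{m/2}|` after multiplication by `Im(z)^{m/2}` (`Mp2.norm_twist_mul_rpow`). By the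
condition on the central character they depend only on the coset of `γ` modulo `Λ Z`, where `Z` is
the finite group of elements of `Γ` that act trivially
(`Mp2.exists_equiv_poincareTerm_eq`). Hence for almost every `z ∈ S` the identity term `f(z)` is
minus the sum of the terms of the other cosets modulo `Λ Z`, and subadditivity of `N = ‖·‖` gives
`N(f(z) Im(z)^{m/2}) ≤ ∑ N(f(γ.z) Im(γ.z)^{m/2})`, the sum being over `γ ∉ Λ Z`.

Integrate this over `S`. Almost every point has a stabilizer that acts trivially
(`Mp2.ae_mem_genericPoints`), and distinct points of `S` are `Γ`-inequivalent. So the translates of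
`S` by representatives of the cosets are disjoint, consist of `Λ`-inequivalent points, and avoid
`Λ.S` except for the identity coset. The right side is thus at most the integral over
`Λ\(Λ.S)ᶜ` (`IsTransversal.tsum_setLIntegral_smul_le`), whereas the left side is the integral over
`Λ\Λ.S`. This contradicts the assumption on `S`.

The same unfolding, applied to a fundamental domain of `Γ` instead of `S` and to absolute values,
bounds the integral of `∑ |f(γ.z) Im(γ.z)^{m/2}|` by a multiple of the integral over `Λ\ℍ`. This
gives absolute convergence almost everywhere and finiteness of the integral of `P f`.

Unfolding needs strict Borel fundamental domains. A discrete subgroup of `Mp2` acts properly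
discontinuously (`Mp2.finite_smul_mem_closedBall`), since `Mp2` is a Hausdorff topological group and
the elements that move `i` into a given ball lie in a compact set. From each orbit one can therefore
choose the point closest to `i`, the first one in lexicographic order (`exists_isTransversal`).
-/

/-! ### The metaplectic group as a topological group -/

namespace Mp2

/-- The quotient of two values of a factor of automorphy avoids the negative real axis, since
`c z + d` and `c i + d` lie in the same open half-plane unless `c = 0`. -/
theorem denom_div_mem_slitPlane {c d : ℝ} (h : (c : ℂ) * Complex.I + d ≠ 0) (z : ℍ) :
    ((c : ℂ) * z + d) / (c * Complex.I + d) ∈ Complex.slitPlane := by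
  rw [Complex.mem_slitPlane_iff_not_le_zero]
  intro hw
  set w := ((c : ℂ) * z + d) / (c * Complex.I + d) with hwdef
  obtain ⟨h1, h2⟩ := Complex.le_def.1 hw
  have him : w.im = 0 := by simpa using h2
  have hre : w.re ≤ 0 := by simpa using h1
  have hw2 : (c : ℂ) * z + d = w * (c * Complex.I + d) := by rw [hwdef, div_mul_cancel₀ _ h]
  have e1 := congrArg Complex.im hw2
  have e2 := congrArg Complex.re hw2
  simp only [Complex.add_im, Complex.add_re, Complex.mul_im, Complex.mul_re, Complex.ofReal_re,
    Complex.ofReal_im, Complex.I_re, Complex.I_im, him, coe_im, coe_re] at e1 e2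
  ring_nf at e1 e2
  have hc : c = 0 := by
    have : c * (z.im - w.re) = 0 := by linarith
    rcases mul_eq_zero.1 this with h | h
    · exact h
    · linarith [z.im_pos]
  subst hc
  have hd : d = 0 := by
    have : d * (1 - w.re) = 0 := by linarith
    rcases mul_eq_zero.1 this with h | h
    · exact h
    · linarith
  exact h (by simp [hd])

theorem denom_I_ne_zero (s : Mp2) : (s.g 1 0 : ℂ) * Complex.I + (s.g 1 1 : ℝ) ≠ 0 := by
  have h := s.sq I
  rw [coe_I] at h
  rw [← h]
  exact pow_ne_zero _ (s.η_ne_zero _)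

/-- The function `η_σ` in terms of `g_σ` and `η_σ(i)`, by means of the principal branch of the
square root. -/
theorem η_eq (s : Mp2) (z : ℍ) :
    s.η z = s.η I * (((s.g 1 0 : ℂ) * z + (s.g 1 1 : ℝ)) /
      ((s.g 1 0 : ℂ) * Complex.I + (s.g 1 1 : ℝ))) ^ (1 / 2 : ℂ) := by
  have h : Set.EqOn (fun z : ℍ => s.η I * (((s.g 1 0 : ℂ) * z + (s.g 1 1 : ℝ)) /
      ((s.g 1 0 : ℂ) * Complex.I + (s.g 1 1 : ℝ))) ^ (1 / 2 : ℂ)) s.η Set.univ := by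
    refine isPreconnected_univ.eq_of_sq_eq (Continuous.continuousOn ?_)
      s.holo.continuous.continuousOn (fun z _ => ?_) (fun {z} _ => s.η_ne_zero z)
      (Set.mem_univ I) ?_
    · refine continuous_const.mul (Continuous.cpow ?_ continuous_const fun z =>
        denom_div_mem_slitPlane s.denom_I_ne_zero z)
      exact Continuous.div_const (by fun_prop) _
    · simp only [Pi.pow_apply]
      rw [mul_pow, ← Complex.cpow_nat_mul, s.sq, s.sq, coe_I]
      simp only [Nat.cast_ofNat]
      rw [show (2 : ℂ) * (1 / 2) = 1 by norm_num, Complex.cpow_one,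
        mul_div_cancel₀ _ s.denom_I_ne_zero]
    · simp only [coe_I]
      rw [div_self s.denom_I_ne_zero, Complex.one_cpow, mul_one]
  exact (h (Set.mem_univ z)).symm

theorem continuous_entry (i j : Fin 2) : Continuous fun s : Mp2 => s.g i j :=
  (continuous_subtype_val.comp continuous_g).matrix_elem i j

theorem continuous_η : Continuous fun p : Mp2 × ℍ => p.1.η p.2 := by
  have h (i j : Fin 2) : Continuous fun p : Mp2 × ℍ => ((p.1.g i j : ℝ) : ℂ) :=
    Complex.continuous_ofReal.comp ((continuous_entry i j).comp continuous_fst)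
  have hz : Continuous fun p : Mp2 × ℍ => (p.2 : ℂ) :=
    UpperHalfPlane.continuous_coe.comp continuous_snd
  rw [funext fun p : Mp2 × ℍ => η_eq p.1 p.2]
  refine (continuous_η_I.comp continuous_fst).mul (Continuous.cpow ?_ continuous_const fun p =>
    denom_div_mem_slitPlane p.1.denom_I_ne_zero p.2)
  exact (((h 1 0).mul hz).add (h 1 1)).div (((h 1 0).mul continuous_const).add (h 1 1))
    fun p => p.1.denom_I_ne_zero

instance : IsTopologicalGroup Mp2 where
  continuous_mul := by
    rw [continuous_induced_rng]
    have h1 : Continuous fun p : Mp2 × Mp2 => p.1.g := continuous_g.comp continuous_fst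
    have h2 : Continuous fun p : Mp2 × Mp2 => p.2.g := continuous_g.comp continuous_snd
    refine (h1.mul h2).prodMk ?_
    change Continuous fun p : Mp2 × Mp2 => p.1.η (p.2.g • I) * p.2.η I
    exact (continuous_η.comp (continuous_fst.prodMk (h2.smul continuous_const))).mul
      (continuous_η_I.comp continuous_snd)
  continuous_inv := by
    rw [continuous_induced_rng]
    have h1 : Continuous fun s : Mp2 => s.g⁻¹ := continuous_g.inv
    refine h1.prodMk ?_
    change Continuous fun s : Mp2 => (s.η (s.g⁻¹ • I))⁻¹
    exact (continuous_η.comp (continuous_id.prodMk (h1.smul continuous_const))).inv₀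
      fun s => s.η_ne_zero _

instance : T2Space Mp2 :=
  T2Space.of_injective_continuous (f := fun s : Mp2 => (s.g, s.η I))
    (fun _ _ h => eq_of_I (congrArg (fun g : SL(2, ℝ) => g • I) (congrArg Prod.fst h))
      (congrArg Prod.snd h))
    continuous_induced_dom

/-! ### Discrete subgroups act properly discontinuously -/

/-- By the Iwasawa decomposition, with `κ_t` needed only for `|t| ≤ 2π`, the elements of `Mp2` that
move `i` into a given ball lie in a compact set. -/
theorem exists_isCompact_of_smul_I_mem_closedBall (R : ℝ) :
    ∃ C : Set Mp2, IsCompact C ∧ {s : Mp2 | s • I ∈ Metric.closedBall I R} ⊆ C := by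
  let q : ℍ × ℝ → ℝ × {y : ℝ // 0 < y} × ℝ := fun p => (p.1.re, ⟨p.1.im, p.1.im_pos⟩, p.2)
  have hq : Continuous q := by
    refine (continuous_re.comp continuous_fst).prodMk (Continuous.prodMk ?_ continuous_snd)
    exact Continuous.subtype_mk (continuous_im.comp continuous_fst) _
  refine ⟨(iwasawa ∘ q) '' (Metric.closedBall I R ×ˢ Set.Icc (-(2 * Real.pi)) (2 * Real.pi)),
    ((isCompact_closedBall I R).prod isCompact_Icc).image (continuous_iwasawa.comp hq), ?_⟩
  intro s hs
  refine ⟨(s • I, 2 * (s.η I).arg), ⟨hs, ?_, ?_⟩, ?_⟩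
  · linarith [Complex.neg_pi_lt_arg (s.η I)]
  · linarith [Complex.arg_le_pi (s.η I)]
  · refine eq_of_I ?_ ?_
    · ext1
      rw [Function.comp_apply, iwasawa_smul_I]
      simp [q, Complex.ext_iff]
    · rw [Function.comp_apply, iwasawa_η_I]
      change (((s • I).im ^ (-(1 / 4) : ℝ) : ℝ) : ℂ) * _ = _
      rw [← norm_η_I]
      conv_rhs => rw [← Complex.norm_mul_exp_arg_mul_I (s.η I)]
      simp [q]

theorem dist_smul_smul (s : Mp2) (z w : ℍ) : dist (s • z) (s • w) = dist z w := by
  rw [smul_def, smul_def]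
  exact dist_smul s.g z w

section Discrete

variable (Γ : Subgroup Mp2) [DiscreteTopology Γ]

/-- A discrete subgroup is closed, so it meets a compact set of `Mp2` in a finite set. -/
theorem finite_smul_mem_closedBall (z : ℍ) (R : ℝ) :
    {γ : Γ | dist (γ • z) I ≤ R}.Finite := by
  obtain ⟨C, hC, hsub⟩ := exists_isCompact_of_smul_I_mem_closedBall (R + dist z I)
  have hcl : IsClosed (Γ : Set Mp2) := Subgroup.isClosed_of_discrete
  have hfin : ((↑) ⁻¹' C : Set Γ).Finite :=
    (hcl.isClosedEmbedding_subtypeVal.isCompact_preimage hC).finite_of_discrete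
  refine hfin.subset fun γ hγ => hsub ?_
  rw [Set.mem_ofPred_eq, Metric.mem_closedBall]
  have h : dist ((γ : Mp2) • z) I ≤ R := hγ
  have h2 := dist_triangle ((γ : Mp2) • I) ((γ : Mp2) • z) I
  rw [dist_smul_smul, dist_comm I z] at h2
  linarith

theorem countable_of_discrete : Countable Γ := by
  have h : (Set.univ : Set Γ) ⊆ ⋃ n : ℕ, {γ : Γ | dist (γ • I) I ≤ n} := fun γ _ =>
    Set.mem_iUnion.2 (exists_nat_ge (dist (γ • I) I))
  exact Set.countable_univ_iff.1
    ((Set.countable_iUnion fun n : ℕ => (finite_smul_mem_closedBall Γ I n).countable).mono h)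

end Discrete

/-! ### Elements that fix points of the upper half-plane -/

/-- An element that acts trivially has lower left entry `0`, so its `η` is constant, which makes it
central. -/
theorem mem_center_of_smul_eq {s : Mp2} (hs : ∀ z : ℍ, s • z = z) :
    s ∈ Subgroup.center Mp2 ∧ ∀ z, s.η z = s.η I := by
  -- Compare the real parts of the fixed point equations at `i` and `2 i`.
  have hc : s.g 1 0 = 0 := by
    have h1 := congrArg UpperHalfPlane.coe (hs I)
    have h2 := congrArg UpperHalfPlane.coe (hs (a ⟨2, two_pos⟩ • I))
    rw [smul_def, coe_specialLinearGroup_apply] at h1 h2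
    rw [a_smul] at h2
    simp only [Algebra.algebraMap_self_apply, coe_I] at h1 h2
    have d1 := s.sq I
    have d2 := s.sq (a ⟨2, two_pos⟩ • I)
    rw [a_smul] at d2
    rw [coe_I] at d1 d2
    have n1 : (s.g 1 0 : ℂ) * Complex.I + (s.g 1 1 : ℂ) ≠ 0 := by
      rw [← d1]; exact pow_ne_zero _ (s.η_ne_zero _)
    have n2 : (s.g 1 0 : ℂ) * ((2 : ℝ) * Complex.I) + (s.g 1 1 : ℂ) ≠ 0 := by
      rw [← d2]; exact pow_ne_zero _ (s.η_ne_zero _)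
    rw [div_eq_iff n1] at h1
    rw [div_eq_iff n2] at h2
    have e1 := congrArg Complex.re h1
    have e2 := congrArg Complex.re h2
    simp at e1 e2
    linarith
  have hη (z : ℍ) : s.η z = s.η I := by
    have h := s.denom_I_ne_zero
    rw [η_eq]
    simp only [hc, Complex.ofReal_zero, zero_mul, zero_add] at h ⊢
    rw [div_self h, Complex.one_cpow, mul_one]
  refine ⟨Subgroup.mem_center_iff.2 fun t => eq_of_I ?_ ?_, hη⟩
  · rw [mul_smul, mul_smul, hs, hs]
  · have h1 : s.g • I = I := hs I
    rw [mul_η, mul_η, h1, hη (t.g • I), mul_comm]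

/-- A nontrivial element of `SL(2, ℝ)` has at most one fixed point on the upper half-plane. -/
theorem smul_eq_of_two_fixed_points {s : Mp2} {z w : ℍ} (hz : s • z = z) (hw : s • w = w) (hzw : z ≠ w)
    (u : ℍ) : s • u = u := by
  -- The real and imaginary parts of `c z² + (d - a) z - b = 0`, the latter divided by `Im z`.
  have key (z : ℍ) : s • z = z ↔ (s.g 1 0 : ℝ) * (z.re ^ 2 - z.im ^ 2)
      + (s.g 1 1 - s.g 0 0) * z.re - s.g 0 1 = 0 ∧ 2 * s.g 1 0 * z.re + (s.g 1 1 - s.g 0 0) = 0 := by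
    have d := s.sq z
    have n : (s.g 1 0 : ℂ) * z + (s.g 1 1 : ℂ) ≠ 0 := by
      rw [← d]; exact pow_ne_zero _ (s.η_ne_zero _)
    rw [UpperHalfPlane.ext_iff, smul_def, coe_specialLinearGroup_apply]
    simp only [Algebra.algebraMap_self_apply]
    rw [div_eq_iff n, Complex.ext_iff]
    simp only [Complex.add_im, Complex.add_re, Complex.mul_im, Complex.mul_re, Complex.ofReal_re,
      Complex.ofReal_im, coe_im, coe_re]
    have hp := z.im_pos
    constructor
    · rintro ⟨h1, h2⟩
      refine ⟨by linarith, ?_⟩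
      have : z.im * (2 * s.g 1 0 * z.re + (s.g 1 1 - s.g 0 0)) = 0 := by linarith
      exact (mul_eq_zero.1 this).resolve_left hp.ne'
    · rintro ⟨h1, h2⟩
      exact ⟨by linarith, by linear_combination (-z.im) * h2⟩
  obtain ⟨z1, z2⟩ := (key z).1 hz
  obtain ⟨w1, w2⟩ := (key w).1 hw
  have hc : s.g 1 0 = 0 := by
    by_contra hc
    have hre : z.re = w.re := by
      have : s.g 1 0 * (z.re - w.re) = 0 := by linarith
      linarith [(mul_eq_zero.1 this).resolve_left hc]
    have him : z.im = w.im := by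
      rw [hre] at z1
      have : s.g 1 0 * ((z.im - w.im) * (z.im + w.im)) = 0 := by linarith
      rcases mul_eq_zero.1 ((mul_eq_zero.1 this).resolve_left hc) with h | h
      · linarith
      · linarith [z.im_pos, w.im_pos]
    exact hzw (UpperHalfPlane.ext (Complex.ext hre him))
  rw [key]
  rw [hc] at z1 z2 ⊢
  have hd : s.g 1 1 - s.g 0 0 = 0 := by linarith
  rw [hd] at z1 ⊢
  constructor <;> linarith

theorem volume_singleton_upperHalfPlane (z : ℍ) : (volume : Measure ℍ) {z} = 0 := by
  rw [volume_eq_lintegral, Set.image_singleton]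
  simp

theorem volume_fixedPoints_eq_zero {s : Mp2} (hs : ¬ ∀ z : ℍ, s • z = z) :
    (volume : Measure ℍ) {z | s • z = z} = 0 := by
  have h : {z : ℍ | s • z = z}.Subsingleton := fun z hz w hw => by
    by_contra hzw
    exact hs fun u => smul_eq_of_two_fixed_points hz hw hzw u
  rcases h.eq_empty_or_singleton with h | ⟨z, h⟩
  · rw [h, measure_empty]
  · rw [h, volume_singleton_upperHalfPlane]

theorem continuous_smul_const (s : Mp2) : Continuous fun z : ℍ => s • z :=
  (continuous_const_smul s.g : Continuous fun z : ℍ => s.g • z)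

instance : ContinuousConstSMul Mp2 ℍ := ⟨continuous_smul_const⟩

instance (Γ : Subgroup Mp2) : ContinuousConstSMul Γ ℍ := ⟨fun γ => continuous_smul_const γ⟩

instance {Γ : Subgroup Mp2} (Λ : Subgroup Γ) : ContinuousConstSMul Λ ℍ :=
  ⟨fun l => continuous_smul_const (l : Γ)⟩

instance : SMulInvariantMeasure Mp2 ℍ volume where
  measure_preimage_smul s _ hA :=
    SMulInvariantMeasure.measure_preimage_smul (μ := (volume : Measure ℍ))
      (s.g : GL (Fin 2) ℝ) hA

end Mp2

/-! ### Strict fundamental domains and unfolding -/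

section Transversal

variable {G X : Type*} [Group G] [MulAction G X]

theorem orbitSet_eq_iUnion (S : Set X) : orbitSet G S = ⋃ g : G, (g • · : X → X) ⁻¹' S := by
  ext x
  simp only [orbitSet, Set.mem_ofPred_eq, Set.mem_iUnion, Set.mem_preimage]
  constructor
  · rintro ⟨g, s, hs, rfl⟩
    exact ⟨g⁻¹, by rwa [inv_smul_smul]⟩
  · rintro ⟨g, hg⟩
    exact ⟨g⁻¹, g • x, hg, inv_smul_smul g x⟩

theorem smul_mem_orbitSet_iff {S : Set X} (g : G) {x : X} :
    g • x ∈ orbitSet G S ↔ x ∈ orbitSet G S := by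
  constructor
  · rintro ⟨h, s, hs, e⟩
    exact ⟨g⁻¹ * h, s, hs, by rw [mul_smul, e, inv_smul_smul]⟩
  · rintro ⟨h, s, hs, rfl⟩
    exact ⟨g * h, s, hs, mul_smul g h s⟩

/-- The subgroup generated by `Λ` and the elements that act trivially. -/
abbrev extendByKer {G : Type*} (X : Type*) [Group G] [MulAction G X] (Λ : Subgroup G) :
    Subgroup G := Λ ⊔ (MulAction.toPermHom G X).ker

theorem mem_ker_iff {g : G} : g ∈ (MulAction.toPermHom G X).ker ↔ ∀ x : X, g • x = x := by
  rw [MonoidHom.mem_ker, Equiv.ext_iff]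
  rfl

variable [MeasurableSpace X]

/-- A strict fundamental domain: a measurable set that contains exactly one point of each orbit. -/
structure IsTransversal (G : Type*) {X : Type*} [Group G] [MulAction G X] [MeasurableSpace X]
    (F : Set X) : Prop where
  measurableSet : MeasurableSet F
  injOn : Set.InjOn (orbitMk G) F
  exists_smul_mem : ∀ x : X, ∃ g : G, g • x ∈ F

theorem measurableSet_orbitSet [Countable G] [MeasurableConstSMul G X] {S : Set X}
    (hS : MeasurableSet S) : MeasurableSet (orbitSet G S) := by
  rw [orbitSet_eq_iUnion]
  exact MeasurableSet.iUnion fun g => measurable_const_smul g hS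

/-- A measurable set of pairwise inequivalent points can be completed to a strict fundamental
domain, by adding the part of a given one that meets none of its orbits. -/
theorem IsTransversal.extend [Countable G] [MeasurableConstSMul G X] {F B : Set X}
    (hF : IsTransversal G F) (hB : MeasurableSet B) (hBi : Set.InjOn (orbitMk G) B) :
    IsTransversal G (B ∪ F \ orbitSet G B) where
  measurableSet := hB.union (hF.measurableSet.diff (measurableSet_orbitSet hB))
  injOn := by
    rintro x (hx | hx) y (hy | hy) hxy
    · exact hBi hx hy hxy
    · obtain ⟨g, hg⟩ := (orbitMk_eq_iff G).1 hxy.symm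
      exact absurd ⟨g, x, hx, hg⟩ hy.2
    · obtain ⟨g, hg⟩ := (orbitMk_eq_iff G).1 hxy
      exact absurd ⟨g, y, hy, hg⟩ hx.2
    · exact hF.injOn hx.1 hy.1 hxy
  exists_smul_mem x := by
    by_cases hx : x ∈ orbitSet G B
    · obtain ⟨g, s, hs, rfl⟩ := hx
      exact ⟨g⁻¹, Or.inl (by rwa [inv_smul_smul])⟩
    · obtain ⟨g, hg⟩ := hF.exists_smul_mem x
      exact ⟨g, Or.inr ⟨hg, fun h => hx ((smul_mem_orbitSet_iff g).1 h)⟩⟩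

/-- A property that is invariant under a countable group and holds almost everywhere on a strict
fundamental domain holds almost everywhere. -/
theorem IsTransversal.ae_of_ae_restrict [Countable G] {μ : Measure X}
    [SMulInvariantMeasure G X μ] {F : Set X} (hF : IsTransversal G F) {p : X → Prop}
    (hp : ∀ (g : G) (x : X), p (g • x) → p x) (h : ∀ᵐ x ∂μ.restrict F, p x) : ∀ᵐ x ∂μ, p x := by
  rw [ae_restrict_iff' hF.measurableSet, ae_iff] at h
  rw [ae_iff]
  refine measure_mono_null (t := ⋃ g : G, (g • · : X → X) ⁻¹' {x | ¬ (x ∈ F → p x)}) ?_ ?_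
  · intro x hx
    obtain ⟨g, hg⟩ := hF.exists_smul_mem x
    exact Set.mem_iUnion.2 ⟨g, fun h => hx (hp g x (h hg))⟩
  · exact measure_iUnion_null fun g => by rw [measure_preimage_smul, h]

variable [Countable G] [MeasurableConstSMul G X] {μ : Measure X} [SMulInvariantMeasure G X μ]

/-- A measurable set of pairwise inequivalent points contributes at most the whole orbit
integral. -/
theorem IsTransversal.setLIntegral_le_orbitLIntegral {F B A : Set X} (hF : IsTransversal G F)
    (hB : MeasurableSet B) (hBi : Set.InjOn (orbitMk G) B) (hBA : B ⊆ A) (hA : MeasurableSet A)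
    (hAG : ∀ (g : G), ∀ x ∈ A, g • x ∈ A) {φ : X → ℝ≥0∞} (hφ : Measurable φ)
    (hφG : ∀ (g : G) (x : X), φ (g • x) = φ x) :
    ∫⁻ x in B, φ x ∂μ ≤ orbitLIntegral G μ A φ := by
  have h := hF.extend hB hBi
  rw [orbitLIntegral_eq G μ h.measurableSet h.injOn h.exists_smul_mem hA hAG hφ hφG]
  exact lintegral_mono_set fun x hx => ⟨Or.inl hx, hBA hx⟩

theorem IsTransversal.orbitLIntegral_orbitSet_eq {F B : Set X} (hF : IsTransversal G F)
    (hB : MeasurableSet B) (hBi : Set.InjOn (orbitMk G) B) {φ : X → ℝ≥0∞} (hφ : Measurable φ)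
    (hφG : ∀ (g : G) (x : X), φ (g • x) = φ x) :
    orbitLIntegral G μ (orbitSet G B) φ = ∫⁻ x in B, φ x ∂μ := by
  have h := hF.extend hB hBi
  rw [orbitLIntegral_eq G μ h.measurableSet h.injOn h.exists_smul_mem (measurableSet_orbitSet hB)
    (fun g x hx => (smul_mem_orbitSet_iff g).2 hx) hφ hφG]
  congr 2
  ext x
  constructor
  · rintro ⟨hx | hx, hx'⟩
    · exact hx
    · exact absurd hx' hx.2
  · exact fun hx => ⟨Or.inl hx, 1, x, hx, one_smul G x⟩

/-- Unfolding, as an inequality. Let the points of `T` be pairwise `G`-inequivalent, with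
stabilizers that act trivially. The translates of `T` by representatives of the right cosets of
`extendByKer X Λ` are pairwise disjoint, and the points of their union are pairwise
`Λ`-inequivalent. -/
theorem IsTransversal.tsum_setLIntegral_smul_le {Λ : Subgroup G} {F T A : Set X}
    (hF : IsTransversal Λ F) (hT : MeasurableSet T) (hTi : Set.InjOn (orbitMk G) T)
    (hstab : ∀ t ∈ T, ∀ g : G, g • t = t → ∀ x : X, g • x = x)
    (R : Set (G ⧸ extendByKer X Λ)) (hR : ∀ r ∈ R, ∀ t ∈ T, r.out⁻¹ • t ∈ A)
    (hA : MeasurableSet A) (hAΛ : ∀ (l : Λ), ∀ x ∈ A, l • x ∈ A)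
    {φ : X → ℝ≥0∞} (hφ : Measurable φ) (hφΛ : ∀ (l : Λ) (x : X), φ (l • x) = φ x) :
    ∑' r : R, ∫⁻ t in T, φ ((r : G ⧸ extendByKer X Λ).out⁻¹ • t) ∂μ ≤ orbitLIntegral Λ μ A φ := by
  have : Countable (G ⧸ extendByKer X Λ) := Quotient.countable
  let B (r : R) : Set X := (((r : G ⧸ extendByKer X Λ).out • ·) : X → X) ⁻¹' T
  have hBm (r : R) : MeasurableSet (B r) := measurable_const_smul _ hT
  have key (r r' : R) (x y : X) (hx : x ∈ B r) (hy : y ∈ B r') (l : Λ) (h : l • y = x) :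
      r = r' ∧ x = y := by
    set g : G := (r : G ⧸ extendByKer X Λ).out with hg
    set g' : G := (r' : G ⧸ extendByKer X Λ).out with hg'
    have hl : (l : G) • y = x := h
    have hxy : g • x = g' • y := by
      refine hTi hx hy ((orbitMk_eq_iff G).2 ⟨g * l * g'⁻¹, ?_⟩)
      change (g * l * g'⁻¹) • g' • y = g • x
      rw [mul_smul, mul_smul, inv_smul_smul, hl]
    have hk : g' * (l : G)⁻¹ * g⁻¹ ∈ (MulAction.toPermHom G X).ker := by
      refine mem_ker_iff.2 (hstab (g • x) hx _ ?_)
      rw [mul_smul, mul_smul, inv_smul_smul, ← hl, inv_smul_smul, hl, hxy]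
    have hk' : g⁻¹ * (g' * (l : G)⁻¹ * g⁻¹) * g⁻¹⁻¹ ∈ (MulAction.toPermHom G X).ker :=
      (MonoidHom.normal_ker _).conj_mem _ hk g⁻¹
    have hrr : r = r' := by
      refine Subtype.ext ?_
      rw [← QuotientGroup.out_eq' (r : G ⧸ extendByKer X Λ),
        ← QuotientGroup.out_eq' (r' : G ⧸ extendByKer X Λ)]
      refine QuotientGroup.eq.2 ?_
      rw [← hg, ← hg']
      have : g⁻¹ * g' = (g⁻¹ * (g' * (l : G)⁻¹ * g⁻¹) * g⁻¹⁻¹) * l := by group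
      rw [this]
      exact mul_mem (Subgroup.mem_sup_right hk') (Subgroup.mem_sup_left l.2)
    refine ⟨hrr, ?_⟩
    have hgg : g = g' := by rw [hg, hg', hrr]
    rw [hgg] at hxy
    exact smul_left_cancel g' hxy
  have hd : Pairwise (Function.onFun Disjoint B) := fun r r' hne =>
    Set.disjoint_left.2 fun x hx hx' => hne (key r r' x x hx hx' 1 (one_smul _ x)).1
  calc ∑' r : R, ∫⁻ t in T, φ ((r : G ⧸ extendByKer X Λ).out⁻¹ • t) ∂μ
      = ∑' r : R, ∫⁻ x in B r, φ x ∂μ := by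
        refine tsum_congr fun r => ?_
        have h := (measurePreserving_smul (r : G ⧸ extendByKer X Λ).out μ).setLIntegral_comp_preimage
          hT (hφ.comp (measurable_const_smul (r : G ⧸ extendByKer X Λ).out⁻¹))
        simp only [Function.comp_apply, inv_smul_smul] at h
        exact h.symm
    _ = ∫⁻ x in ⋃ r, B r, φ x ∂μ := (lintegral_iUnion hBm hd φ).symm
    _ ≤ _ := by
        refine hF.setLIntegral_le_orbitLIntegral (MeasurableSet.iUnion hBm) ?_ ?_ hA hAΛ hφ hφΛ
        · intro x hx y hy hxy
          obtain ⟨r, hx⟩ := Set.mem_iUnion.1 hx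
          obtain ⟨r', hy⟩ := Set.mem_iUnion.1 hy
          obtain ⟨l, hl⟩ := (orbitMk_eq_iff Λ).1 hxy
          exact (key r r' x y hx hy l hl).2
        · refine Set.iUnion_subset fun r x hx => ?_
          have := hR r r.2 _ hx
          rwa [inv_smul_smul] at this

end Transversal

/-- A properly discontinuous action on the upper half-plane has a strict fundamental domain: from
each orbit, choose the point closest to `i`, breaking ties by the lexicographic order of
coordinates. -/
theorem exists_isTransversal (G : Type*) [Group G] [Countable G] [MulAction G ℍ]
    [MeasurableConstSMul G ℍ] (hfin : ∀ (z : ℍ) (R : ℝ), {g : G | dist (g • z) I ≤ R}.Finite) :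
    ∃ F : Set ℍ, IsTransversal G F := by
  let key (z : ℍ) : ℝ ×ₗ ℝ ×ₗ ℝ := toLex (dist z I, toLex (z.re, z.im))
  have hle (z w : ℍ) : key z ≤ key w ↔ dist z I < dist w I ∨
      dist z I = dist w I ∧ (z.re < w.re ∨ z.re = w.re ∧ z.im ≤ w.im) := by
    simp only [key, Prod.Lex.le_iff, ofLex_toLex]
  have hkey : Function.Injective key := fun z w h => by
    have h1 := congrArg (fun p => (ofLex (ofLex p).2).1) h
    have h2 := congrArg (fun p => (ofLex (ofLex p).2).2) h
    exact UpperHalfPlane.ext (Complex.ext h1 h2)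
  refine ⟨⋂ g : G, {z | key z ≤ key (g • z)}, ?_, ?_, ?_⟩
  · refine MeasurableSet.iInter fun g => ?_
    simp only [hle]
    have hg : Measurable fun z : ℍ => g • z := measurable_const_smul g
    have hd : Measurable fun z : ℍ => dist z I := (continuous_id.dist continuous_const).measurable
    have hr : Measurable fun z : ℍ => z.re := continuous_re.measurable
    have hi : Measurable fun z : ℍ => z.im := continuous_im.measurable
    have hd' := hd.comp hg
    have hr' := hr.comp hg
    have hi' := hi.comp hg
    exact (measurableSet_lt hd hd').union ((measurableSet_eq_fun hd hd').inter
      ((measurableSet_lt hr hr').union ((measurableSet_eq_fun hr hr').inter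
        (measurableSet_le hi hi'))))
  · intro x hx y hy hxy
    obtain ⟨g, hg⟩ := (orbitMk_eq_iff G).1 hxy
    have h1 : key y ≤ key (g • y) := Set.mem_iInter.1 hy g
    have h2 : key x ≤ key (g⁻¹ • x) := Set.mem_iInter.1 hx g⁻¹
    rw [hg] at h1
    rw [← hg, inv_smul_smul, hg] at h2
    exact hkey (le_antisymm h2 h1)
  · intro z
    obtain ⟨g, hg, hmin⟩ := Set.exists_min_image _ (fun g : G => key (g • z))
      (hfin z (dist z I)) ⟨1, by simp⟩
    refine ⟨g, Set.mem_iInter.2 fun h => ?_⟩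
    change key (g • z) ≤ key (h • g • z)
    rw [← mul_smul]
    by_cases hh : dist ((h * g) • z) I ≤ dist z I
    · exact hmin _ hh
    · exact (hle _ _).2 (Or.inl (lt_of_le_of_lt hg (not_le.1 hh)))

/-! ### Generic points -/

namespace Mp2

section Generic

variable (Γ : Subgroup Mp2)

/-- The points whose stabilizer in `Γ` acts trivially on the upper half-plane. -/
def genericPoints : Set ℍ := {z | ∀ γ : Γ, γ • z = z → ∀ x : ℍ, γ • x = x}

theorem measurableSet_genericPoints [Countable Γ] : MeasurableSet (genericPoints Γ) := by
  have h : genericPoints Γ = ⋂ γ : Γ, ({z : ℍ | γ • z = z}ᶜ ∪ {_z | ∀ x : ℍ, γ • x = x}) := by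
    ext z
    simp [genericPoints, imp_iff_not_or]
  rw [h]
  refine MeasurableSet.iInter fun γ => MeasurableSet.union ?_ (MeasurableSet.const _)
  exact (isClosed_eq (continuous_const_smul γ) continuous_id).measurableSet.compl

theorem ae_mem_genericPoints [Countable Γ] : ∀ᵐ z : ℍ, z ∈ genericPoints Γ := by
  refine ae_all_iff.2 fun γ => ?_
  by_cases h : ∀ x : ℍ, γ • x = x
  · exact Filter.Eventually.of_forall fun _ _ => h
  · have h0 : (volume : Measure ℍ) {z | (γ : Mp2) • z = z} = 0 := volume_fixedPoints_eq_zero h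
    filter_upwards [compl_mem_ae_iff.2 h0] with z hz hz'
    exact absurd hz' hz

end Generic

/-! ### The terms of the Poincaré series -/

theorem slash_mul (k : ℕ) (f : ℍ → ℂ) (s t : Mp2) (z : ℍ) :
    slash k f (s * t) z = slash k f s (t • z) * t.η z ^ (-(2 * k + 1) : ℤ) := by
  rw [slash, slash, mul_η, mul_zpow, mul_smul, mul_assoc]
  rfl

/-- The transformation law `Im(σ.z)^{m/2} = |η_σ(z)|^{-2m} Im(z)^{m/2}`. -/
theorem im_rpow_smul (k : ℕ) (s : Mp2) (z : ℍ) :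
    (s • z).im ^ (weight k / 2) = ‖s.η z‖ ^ (-(2 * k + 1) : ℤ) * z.im ^ (weight k / 2) := by
  have h1 : (s • z).im = z.im / ‖s.η z‖ ^ 4 := by
    rw [smul_def, SL_smul_eq, im_smul_eq_div_normSq, denom_SL, ← s.sq, Complex.normSq_eq_norm_sq,
      norm_pow, ← pow_mul]
    simp
  have h2 : (‖s.η z‖ ^ 4) ^ (weight k / 2) = ‖s.η z‖ ^ (2 * k + 1) := by
    rw [← Real.rpow_natCast, ← Real.rpow_mul (norm_nonneg _), ← Real.rpow_natCast, weight]
    congr 1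
    push_cast
    ring
  rw [h1, Real.div_rpow z.im_pos.le (by positivity), h2, zpow_neg, div_eq_inv_mul]
  norm_cast

theorem norm_slash_mul_rpow (k : ℕ) (f : ℍ → ℂ) (s : Mp2) (z : ℍ) :
    ‖slash k f s z * ((z.im ^ (weight k / 2) : ℝ) : ℂ)‖ = ‖weighted k f (s • z)‖ := by
  rw [weighted, im_rpow_smul, slash, norm_mul, norm_mul, norm_mul, Complex.norm_real,
    Complex.norm_real, norm_zpow, norm_mul, norm_zpow, norm_norm, mul_assoc]

theorem weighted_eq_zero_iff (k : ℕ) (f : ℍ → ℂ) (z : ℍ) : weighted k f z = 0 ↔ f z = 0 := by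
  have h : ((z.im ^ (weight k / 2) : ℝ) : ℂ) ≠ 0 :=
    Complex.ofReal_ne_zero.2 (Real.rpow_pos_of_pos z.im_pos _).ne'
  rw [weighted, mul_eq_zero, or_iff_left h]

theorem measurable_weighted (k : ℕ) {f : ℍ → ℂ} (hf : Measurable f) :
    Measurable (weighted k f) :=
  hf.mul (Complex.measurable_ofReal.comp (continuous_im.measurable.pow_const _))

variable {Γ : Subgroup Mp2} (Λ : Subgroup Γ) (χ : Γ →* Circle) (k : ℕ) (f : ℍ → ℂ)

/-- The function `conj χ(γ) f|_m γ`, a term of the Poincaré series. -/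
noncomputable def twist (γ : Γ) (z : ℍ) : ℂ := conj (χ γ : ℂ) * slash k f (γ : Mp2) z

theorem norm_twist_mul_rpow (γ : Γ) (z : ℍ) :
    ‖twist χ k f γ z * ((z.im ^ (weight k / 2) : ℝ) : ℂ)‖ = ‖weighted k f (γ • z)‖ := by
  rw [twist, mul_assoc, norm_mul, norm_slash_mul_rpow, RCLike.norm_conj, Circle.norm_coe, one_mul]
  rfl

theorem twist_one (z : ℍ) : twist χ k f 1 z = f z := by
  simp [twist, slash]

theorem twist_smul (γ σ : Γ) (z : ℍ) :
    twist χ k f γ (σ • z)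
      = (χ σ : ℂ) * (σ : Mp2).η z ^ (2 * k + 1 : ℤ) * twist χ k f (γ * σ) z := by
  have h : (σ : Mp2).η z ^ (2 * k + 1 : ℤ) * (σ : Mp2).η z ^ (-(2 * k + 1) : ℤ) = 1 := by
    rw [← zpow_add₀ (η_ne_zero _ _)]; simp
  have hσ : (χ σ : ℂ) * conj (χ σ : ℂ) = 1 := by
    rw [Complex.mul_conj, Circle.normSq_coe, Complex.ofReal_one]
  rw [twist, twist, Subgroup.coe_mul, slash_mul, map_mul, Circle.coe_mul, map_mul]
  change _ * slash k f γ ((σ : Mp2) • z) = _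
  linear_combination (-(conj (χ γ : ℂ) * slash k f γ ((σ : Mp2) • z))) * h
    - (conj (χ γ : ℂ) * slash k f γ ((σ : Mp2) • z)) * (σ : Mp2).η z ^ (2 * k + 1 : ℤ)
      * (σ : Mp2).η z ^ (-(2 * k + 1) : ℤ) * hσ

variable {Λ χ k f}

theorem measurable_twist (hf : Measurable f) (γ : Γ) : Measurable (twist χ k f γ) := by
  have h1 : Measurable fun z : ℍ => f ((γ : Mp2) • z) :=
    hf.comp (continuous_const_smul (γ : Mp2)).measurable
  have h2 : Measurable fun z : ℍ => (γ : Mp2).η z ^ (-(2 * k + 1) : ℤ) :=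
    (γ : Mp2).holo.continuous.measurable.pow_const _
  exact (h1.mul h2).const_mul _

theorem twist_mul_left {l : Γ} (hl : ∀ z : ℍ, slash k f (l : Mp2) z = (χ l : ℂ) * f z) (γ : Γ) :
    twist χ k f (l * γ) = twist χ k f γ := by
  funext z
  have h : conj (χ l : ℂ) * (χ l : ℂ) = 1 := by
    rw [mul_comm, Complex.mul_conj, Circle.normSq_coe, Complex.ofReal_one]
  rw [twist, twist, Subgroup.coe_mul, slash_mul, hl, map_mul, Circle.coe_mul, map_mul, slash]
  linear_combination (conj (χ γ : ℂ) * f ((γ : Mp2) • z) *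
    (γ : Mp2).η z ^ (-(2 * k + 1) : ℤ)) * h

/-- The condition on the central character extends the transformation law of `f` from `Λ` to the
elements that act trivially. -/
theorem slash_eq_of_mem_extendByKer
    (hf1 : ∀ l : Γ, l ∈ Λ → ∀ z : ℍ, slash k f (l : Mp2) z = (χ l : ℂ) * f z)
    (hχ : ∀ δ : Γ, (δ : Mp2) ∈ Subgroup.center Mp2 → (χ δ : ℂ) = chiK k (δ : Mp2))
    (l : Γ) (hl : l ∈ extendByKer ℍ Λ) (z : ℍ) : slash k f (l : Mp2) z = (χ l : ℂ) * f z := by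
  obtain ⟨l, hl', δ, hδ, rfl⟩ := Subgroup.mem_sup_of_normal_right.1 hl
  have hδ' : ∀ x : ℍ, (δ : Mp2) • x = x := mem_ker_iff.1 hδ
  obtain ⟨hc, hη⟩ := mem_center_of_smul_eq hδ'
  rw [Subgroup.coe_mul, slash_mul, hδ', hf1 l hl', hη z, map_mul, Circle.coe_mul, hχ δ hc, chiK]
  ring

/-- A function that is left-invariant under `L` takes the same value at any representative of the
coset `L g⁻¹`. Right cosets are encoded as inverses of left cosets. -/
theorem apply_out_inv {G α : Type*} [Group G] {L : Subgroup G} {h : G → α}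
    (hh : ∀ l ∈ L, ∀ g, h (l * g) = h g) (g : G) : h (g : G ⧸ L).out⁻¹ = h g⁻¹ := by
  obtain ⟨l, hl⟩ := QuotientGroup.mk_out_eq_mul L g
  rw [hl, mul_inv_rev, hh _ (inv_mem l.2)]

/-- Right multiplication by `s` permutes the right cosets of `L`. -/
theorem apply_out_inv_mul {G α : Type*} [Group G] {L : Subgroup G} {h : G → α}
    (hh : ∀ l ∈ L, ∀ g, h (l * g) = h g) (s : G) (q : G ⧸ L) :
    h (q.out⁻¹ * s) = h (MulAction.toPerm s⁻¹ q).out⁻¹ := by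
  have : MulAction.toPerm s⁻¹ q = ((s⁻¹ * q.out : G) : G ⧸ L) := by
    conv_lhs => rw [← QuotientGroup.out_eq' q]
    rfl
  rw [this, apply_out_inv hh, mul_inv_rev, inv_inv]

section Series

variable (hf1 : ∀ l : Γ, l ∈ Λ → ∀ z : ℍ, slash k f (l : Mp2) z = (χ l : ℂ) * f z)
include hf1

theorem norm_weighted_smul (l : Λ) (z : ℍ) : ‖weighted k f (l • z)‖ = ‖weighted k f z‖ := by
  have h := norm_slash_mul_rpow k f ((l : Γ) : Mp2) z
  rw [hf1 l l.2, mul_assoc, norm_mul, Circle.norm_coe, one_mul] at h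
  exact h.symm

theorem poincareTerm_eq (z : ℍ) (q : Quotient (QuotientGroup.rightRel Λ)) :
    poincareTerm Λ χ k f z q
      = twist χ k f (QuotientGroup.quotientRightRelEquivQuotientLeftRel Λ q).out⁻¹ z := by
  have h : QuotientGroup.quotientRightRelEquivQuotientLeftRel Λ q = ((q.out⁻¹ : Γ) : Γ ⧸ Λ) := by
    conv_lhs => rw [← Quotient.out_eq q]
    rfl
  rw [h, apply_out_inv (h := twist χ k f) fun l hl => twist_mul_left (hf1 l hl), inv_inv]
  rfl

theorem poincare_eq (z : ℍ) :
    poincare Λ χ k f z = ∑' q : Γ ⧸ Λ, twist χ k f q.out⁻¹ z := by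
  rw [poincare, ← (QuotientGroup.quotientRightRelEquivQuotientLeftRel Λ).tsum_eq]
  exact tsum_congr fun q => poincareTerm_eq hf1 z q

/-- The Poincaré series has the transformation law of weight `m` and character `χ` under `Γ`. It
holds at every point, also where the series diverges and `tsum` is `0`. -/
theorem poincare_smul (σ : Γ) (z : ℍ) :
    poincare Λ χ k f (σ • z)
      = (χ σ : ℂ) * (σ : Mp2).η z ^ (2 * k + 1 : ℤ) * poincare Λ χ k f z := by
  rw [poincare_eq hf1, poincare_eq hf1, ← (MulAction.toPerm (β := Γ ⧸ Λ) σ⁻¹).tsum_eq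
    (fun q => twist χ k f q.out⁻¹ z), ← tsum_mul_left]
  refine tsum_congr fun q => ?_
  rw [twist_smul, ← apply_out_inv_mul (h := twist χ k f) fun l hl => twist_mul_left (hf1 l hl)]

theorem norm_weighted_poincare_smul (σ : Γ) (z : ℍ) :
    ‖weighted k (poincare Λ χ k f) (σ • z)‖ = ‖weighted k (poincare Λ χ k f) z‖ := by
  have h : ‖(σ : Mp2).η z‖ ≠ 0 := norm_ne_zero_iff.2 (η_ne_zero _ _)
  have him : (σ • z).im ^ (weight k / 2)
      = ‖(σ : Mp2).η z‖ ^ (-(2 * k + 1) : ℤ) * z.im ^ (weight k / 2) := im_rpow_smul k σ z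
  have h1 : ‖(σ : Mp2).η z‖ ^ (2 * k + 1 : ℤ) * ‖(σ : Mp2).η z‖ ^ (-(2 * k + 1) : ℤ) = 1 := by
    rw [← zpow_add₀ h]; simp
  rw [weighted, weighted, poincare_smul hf1, him, norm_mul, norm_mul, norm_mul, norm_mul,
    Circle.norm_coe, Complex.norm_real, Complex.norm_real, norm_zpow, norm_mul, norm_zpow,
    norm_norm]
  linear_combination ‖poincare Λ χ k f z‖ * ‖z.im ^ (weight k / 2)‖ * h1

theorem measurable_poincare [Countable Γ] (hf : Measurable f) :
    Measurable (poincare Λ χ k f) := by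
  rw [funext fun z => poincare_eq hf1 z]
  have : Countable (Γ ⧸ Λ) := Quotient.countable
  exact Measurable.tsum fun q => measurable_twist hf _

end Series

/-- `Λ` has finite index in the subgroup generated by it and the elements acting trivially. -/
theorem finite_quotient_extendByKer [DiscreteTopology Γ] (Λ : Subgroup Γ) :
    Finite (extendByKer ℍ Λ ⧸ Λ.subgroupOf (extendByKer ℍ Λ)) := by
  have hfin : Finite (MulAction.toPermHom Γ ℍ).ker := by
    refine ((finite_smul_mem_closedBall Γ I 0).subset fun γ hγ => ?_).to_subtype
    rw [Set.mem_ofPred_eq, mem_ker_iff.1 hγ, dist_self]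
  refine Finite.of_surjective (fun δ : (MulAction.toPermHom Γ ℍ).ker =>
    ((⟨δ, Subgroup.mem_sup_right δ.2⟩ : extendByKer ℍ Λ) :
      extendByKer ℍ Λ ⧸ Λ.subgroupOf (extendByKer ℍ Λ))) fun q => ?_
  obtain ⟨⟨x, hx⟩, rfl⟩ := QuotientGroup.mk_surjective q
  have hx' := hx
  rw [extendByKer, sup_comm] at hx'
  obtain ⟨δ, hδ, l, hl, rfl⟩ := Subgroup.mem_sup_of_normal_left.1 hx'
  refine ⟨⟨δ, hδ⟩, QuotientGroup.eq.2 ?_⟩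
  rw [Subgroup.mem_subgroupOf]
  simpa using hl

section Collapse

variable (hf1 : ∀ l : Γ, l ∈ Λ → ∀ z : ℍ, slash k f (l : Mp2) z = (χ l : ℂ) * f z)
  (hχ : ∀ δ : Γ, (δ : Mp2) ∈ Subgroup.center Mp2 → (χ δ : ℂ) = chiK k (δ : Mp2))
include hf1 hχ

/-- The terms of the Poincaré series depend only on cosets of `extendByKer ℍ Λ`: each value occurs
as often as the index of `Λ` in that subgroup. -/
theorem exists_equiv_poincareTerm_eq :
    ∃ e : Quotient (QuotientGroup.rightRel Λ) ≃
      (Γ ⧸ extendByKer ℍ Λ) × (extendByKer ℍ Λ ⧸ Λ.subgroupOf (extendByKer ℍ Λ)),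
      ∀ z q, poincareTerm Λ χ k f z q = twist χ k f (e q).1.out⁻¹ z := by
  refine ⟨(QuotientGroup.quotientRightRelEquivQuotientLeftRel Λ).trans
    (Subgroup.quotientEquivProdOfLE le_sup_left), fun z q => ?_⟩
  rw [poincareTerm_eq hf1, Equiv.trans_apply]
  generalize QuotientGroup.quotientRightRelEquivQuotientLeftRel Λ q = r
  obtain ⟨γ, rfl⟩ := QuotientGroup.mk_surjective r
  rw [apply_out_inv (h := twist χ k f) fun l hl => twist_mul_left (hf1 l hl)]
  change _ = twist χ k f (γ : Γ ⧸ extendByKer ℍ Λ).out⁻¹ z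
  rw [apply_out_inv (h := twist χ k f) fun l hl =>
    twist_mul_left (slash_eq_of_mem_extendByKer hf1 hχ l hl)]

variable [DiscreteTopology Γ]

theorem tsum_enorm_poincareTerm_eq (z : ℍ) :
    ∑' q, ‖poincareTerm Λ χ k f z q‖ₑ
      = Nat.card (extendByKer ℍ Λ ⧸ Λ.subgroupOf (extendByKer ℍ Λ)) *
        ∑' r : Γ ⧸ extendByKer ℍ Λ, ‖twist χ k f r.out⁻¹ z‖ₑ := by
  obtain ⟨e, he⟩ := exists_equiv_poincareTerm_eq hf1 hχ
  have := finite_quotient_extendByKer Λ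
  rw [tsum_congr fun q => congrArg enorm (he z q),
    e.tsum_eq (fun p => ‖twist χ k f p.1.out⁻¹ z‖ₑ), ENNReal.tsum_prod', ← ENNReal.tsum_mul_left]
  refine tsum_congr fun r => ?_
  dsimp only
  rw [ENNReal.tsum_const, ENat.card_eq_coe_natCard, ENat.toENNReal_coe]

/-- Absolute convergence and vanishing of the Poincaré series pass to the sum over cosets of
`extendByKer ℍ Λ`, since the two series differ by a nonzero integer factor. -/
theorem summable_norm_twist_and_tsum_eq_zero {z : ℍ}
    (hs : Summable fun q => ‖poincareTerm Λ χ k f z q‖)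
    (h0 : poincare Λ χ k f z = 0) :
    (Summable fun r : Γ ⧸ extendByKer ℍ Λ => ‖twist χ k f r.out⁻¹ z‖) ∧
      ∑' r : Γ ⧸ extendByKer ℍ Λ, twist χ k f r.out⁻¹ z = 0 := by
  obtain ⟨e, he⟩ := exists_equiv_poincareTerm_eq hf1 hχ
  have := finite_quotient_extendByKer Λ
  have hs' : Summable fun p : (Γ ⧸ extendByKer ℍ Λ) ×
      (extendByKer ℍ Λ ⧸ Λ.subgroupOf (extendByKer ℍ Λ)) => ‖twist χ k f p.1.out⁻¹ z‖ := by
    rw [← e.summable_iff]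
    exact hs.congr fun q => congrArg norm (he z q)
  refine ⟨hs'.comp_injective (i := fun r => (r, ((1 : extendByKer ℍ Λ) : _ ⧸ _)))
    (fun r r' h => (Prod.ext_iff.1 h).1), ?_⟩
  rw [poincare, tsum_congr fun q => he z q, e.tsum_eq (fun p => twist χ k f p.1.out⁻¹ z),
    hs'.of_norm.tsum_prod] at h0
  simp only [tsum_const, nsmul_eq_mul] at h0
  rw [tsum_mul_left] at h0
  refine (mul_eq_zero.1 h0).resolve_left ?_
  exact_mod_cast Nat.card_pos.ne'

end Collapse

end Mp2

/-! ### Integrability and nonvanishing of the Poincaré series -/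

/-- Countable subadditivity along `ℕ` implies countable subadditivity over any countable type. -/
theorem coe_apply_tsum_le {N : ℂ → ℝ≥0} (hN1 : N 0 = 0)
    (hN3 : ∀ z : ℕ → ℂ, (Summable fun i => ‖z i‖) →
      (N (∑' i, z i) : ℝ≥0∞) ≤ ∑' i, (N (z i) : ℝ≥0∞))
    {ι : Type*} [Countable ι] {z : ι → ℂ} (hz : Summable fun i => ‖z i‖) :
    (N (∑' i, z i) : ℝ≥0∞) ≤ ∑' i, (N (z i) : ℝ≥0∞) := by
  obtain ⟨e, he⟩ := exists_injective_nat ι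
  have h1 : (fun i => ‖Function.extend e z 0 i‖) = Function.extend e (fun i => ‖z i‖) 0 := by
    funext i
    rw [Function.apply_extend norm]
    congr 1
    funext j
    simp
  have h2 : (fun i => (N (Function.extend e z 0 i) : ℝ≥0∞))
      = Function.extend e (fun i => (N (z i) : ℝ≥0∞)) 0 := by
    funext i
    rw [Function.apply_extend fun w => (N w : ℝ≥0∞)]
    congr 1
    funext j
    simp [hN1]
  have h := hN3 (Function.extend e z 0) (by rw [h1]; exact (summable_extend_zero he).2 hz)
  rwa [tsum_extend_zero he, h2, tsum_extend_zero he] at h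

namespace Mp2

variable {Γ : Subgroup Mp2} [DiscreteTopology Γ] {Λ : Subgroup Γ} {χ : Γ →* Circle} {k : ℕ}
  {f : ℍ → ℂ}

theorem exists_isTransversal_of_discrete (Γ : Subgroup Mp2) [DiscreteTopology Γ] :
    ∃ F : Set ℍ, IsTransversal Γ F :=
  have := countable_of_discrete Γ
  exists_isTransversal Γ (finite_smul_mem_closedBall Γ)

theorem exists_isTransversal_subgroup (Λ : Subgroup Γ) : ∃ F : Set ℍ, IsTransversal Λ F :=
  have := countable_of_discrete Γ
  exists_isTransversal Λ fun z R =>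
    (finite_smul_mem_closedBall Γ z R).preimage Subtype.val_injective.injOn

section

variable (hf1 : ∀ l : Γ, l ∈ Λ → ∀ z : ℍ, slash k f (l : Mp2) z = (χ l : ℂ) * f z)
include hf1

theorem orbitLIntegral_weighted_poincare_eq (hf : Measurable f) {F : Set ℍ} (hF : IsTransversal Γ F) :
    orbitLIntegral Γ volume Set.univ (fun z => ‖weighted k (poincare Λ χ k f) z‖ₑ)
      = ∫⁻ z in F, ‖weighted k (poincare Λ χ k f) z‖ₑ := by
  have hc := countable_of_discrete Γ
  rw [orbitLIntegral_eq Γ volume hF.measurableSet hF.injOn hF.exists_smul_mem MeasurableSet.univ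
    (fun _ _ _ => Set.mem_univ _) (measurable_weighted k (measurable_poincare hf1 hf)).enorm
    (fun σ z => by rw [← ofReal_norm, norm_weighted_poincare_smul hf1, ofReal_norm]),
    Set.inter_univ]

theorem ae_poincare_eq_zero_of_orbitLIntegral_eq_zero (hf : Measurable f)
    (h : orbitLIntegral Γ volume Set.univ (fun z => ‖weighted k (poincare Λ χ k f) z‖ₑ) = 0) :
    ∀ᵐ z : ℍ, poincare Λ χ k f z = 0 := by
  have hc := countable_of_discrete Γ
  obtain ⟨F, hF⟩ := exists_isTransversal_of_discrete Γ
  rw [orbitLIntegral_weighted_poincare_eq hf1 hf hF,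
    lintegral_eq_zero_iff (measurable_weighted k (measurable_poincare hf1 hf)).enorm] at h
  refine hF.ae_of_ae_restrict (fun σ z h0 => ?_) ?_
  · rw [← weighted_eq_zero_iff k, ← norm_eq_zero] at h0 ⊢
    rwa [norm_weighted_poincare_smul hf1] at h0
  · filter_upwards [h] with z hz
    exact (weighted_eq_zero_iff k _ z).1 (enorm_eq_zero.1 hz)

variable (hχ : ∀ δ : Γ, (δ : Mp2) ∈ Subgroup.center Mp2 → (χ δ : ℂ) = chiK k (δ : Mp2))
include hχ

/-- At a point where the Poincaré series converges absolutely and vanishes, its identity term is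
minus the sum of the others. -/
theorem coe_apply_weighted_le_of_poincare_eq_zero {N : ℂ → ℝ≥0} (hN1 : N 0 = 0)
    (hN2 : ∀ z : ℂ, N z = N ((‖z‖ : ℝ) : ℂ))
    (hN3 : ∀ z : ℕ → ℂ, (Summable fun i => ‖z i‖) →
      (N (∑' i, z i) : ℝ≥0∞) ≤ ∑' i, (N (z i) : ℝ≥0∞))
    {z : ℍ} (hs : Summable fun q => ‖poincareTerm Λ χ k f z q‖) (h0 : poincare Λ χ k f z = 0) :
    (N (weighted k f z) : ℝ≥0∞) ≤
      ∑' r : ({((1 : Γ) : Γ ⧸ extendByKer ℍ Λ)}ᶜ : Set (Γ ⧸ extendByKer ℍ Λ)),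
        (N (weighted k f ((r : Γ ⧸ extendByKer ℍ Λ).out⁻¹ • z)) : ℝ≥0∞) := by
  have hc := countable_of_discrete Γ
  have : Countable (Γ ⧸ extendByKer ℍ Λ) := Quotient.countable
  have hN {v w : ℂ} (h : ‖v‖ = ‖w‖) : N v = N w := by rw [hN2 v, hN2 w, h]
  obtain ⟨hs', h0'⟩ := summable_norm_twist_and_tsum_eq_zero hf1 hχ hs h0
  set y : ℂ := ((z.im ^ (weight k / 2) : ℝ) : ℂ) with hy
  have hsy : Summable fun r : Γ ⧸ extendByKer ℍ Λ => ‖twist χ k f r.out⁻¹ z * y‖ := by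
    simp only [norm_mul]
    exact hs'.mul_right _
  have hsum := hsy.of_norm.tsum_subtype_add_tsum_subtype_compl {((1 : Γ) : Γ ⧸ extendByKer ℍ Λ)}
  have hzero : ∑' r : Γ ⧸ extendByKer ℍ Λ, twist χ k f r.out⁻¹ z * y = 0 := by
    rw [tsum_mul_right, h0', zero_mul]
  rw [hzero, tsum_singleton _ fun r : Γ ⧸ extendByKer ℍ Λ =>
    twist χ k f r.out⁻¹ z * y, apply_out_inv (h := twist χ k f) fun l hl =>
    twist_mul_left (slash_eq_of_mem_extendByKer hf1 hχ l hl), inv_one, twist_one] at hsum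
  have h1 : N (weighted k f z) = N (∑' r : ({((1 : Γ) : Γ ⧸ extendByKer ℍ Λ)}ᶜ :
      Set (Γ ⧸ extendByKer ℍ Λ)), twist χ k f (r : Γ ⧸ extendByKer ℍ Λ).out⁻¹ z * y) := by
    refine hN ?_
    rw [eq_neg_of_add_eq_zero_right hsum, norm_neg]
    rfl
  rw [h1]
  refine (coe_apply_tsum_le hN1 hN3 (hsy.subtype _)).trans_eq (tsum_congr fun r => ?_)
  rw [hN (norm_twist_mul_rpow χ k f _ z)]

variable (hf : Measurable f)
  (hf2 : orbitLIntegral Λ volume Set.univ (fun z => ‖weighted k f z‖ₑ) < ∞)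
include hf hf2

/-- By unfolding, the sum of the absolute values of the terms of the Poincaré series is integrable
over a fundamental domain. -/
theorem setLIntegral_tsum_enorm_poincareTerm_lt_top {F : Set ℍ} (hF : IsTransversal Γ F) :
    ∫⁻ z in F, ∑' q, ‖poincareTerm Λ χ k f z q * ((z.im ^ (weight k / 2) : ℝ) : ℂ)‖ₑ < ∞ := by
  have hc := countable_of_discrete Γ
  have : Countable (Γ ⧸ extendByKer ℍ Λ) := Quotient.countable
  have hfin := finite_quotient_extendByKer Λ
  obtain ⟨FΛ, hFΛ⟩ := exists_isTransversal_subgroup Λ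
  have hφ : Measurable fun z => ‖weighted k f z‖ₑ := (measurable_weighted k hf).enorm
  have hφr (g : Γ) : Measurable fun z : ℍ => ‖weighted k f (g • z)‖ₑ :=
    hφ.comp (measurable_const_smul g)
  have h1 (z : ℍ) : ∑' q, ‖poincareTerm Λ χ k f z q * ((z.im ^ (weight k / 2) : ℝ) : ℂ)‖ₑ
      = Nat.card (extendByKer ℍ Λ ⧸ Λ.subgroupOf (extendByKer ℍ Λ)) *
        ∑' r : Γ ⧸ extendByKer ℍ Λ, ‖weighted k f (r.out⁻¹ • z)‖ₑ := by
    simp only [enorm_mul]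
    rw [ENNReal.tsum_mul_right, tsum_enorm_poincareTerm_eq hf1 hχ, mul_assoc,
      ← ENNReal.tsum_mul_right]
    congr 1
    refine tsum_congr fun r => ?_
    rw [← enorm_mul, ← ofReal_norm, norm_twist_mul_rpow, ofReal_norm]
  -- Almost every point is generic, and unfolding applies to the generic points of `F`.
  have hae : (F ∩ genericPoints Γ : Set ℍ) =ᵐ[volume] F :=
    inter_ae_eq_left_of_ae_eq_univ (Filter.eventuallyEq_univ.2 (ae_mem_genericPoints Γ))
  simp only [h1]
  rw [lintegral_const_mul _ (Measurable.tsum fun r => hφr _),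
    ← setLIntegral_congr hae, lintegral_tsum fun r => (hφr _).aemeasurable]
  refine ENNReal.mul_lt_top (ENNReal.natCast_lt_top _) (lt_of_le_of_lt ?_ hf2)
  have h := hFΛ.tsum_setLIntegral_smul_le (μ := (volume : Measure ℍ)) (A := Set.univ)
    (hF.measurableSet.inter (measurableSet_genericPoints Γ)) (hF.injOn.mono Set.inter_subset_left)
    (fun t ht => ht.2) Set.univ (fun _ _ _ _ => Set.mem_univ _) MeasurableSet.univ
    (fun _ _ _ => Set.mem_univ _) hφ (fun l x => by
      rw [← ofReal_norm, norm_weighted_smul hf1, ofReal_norm])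
  rwa [tsum_univ fun r : Γ ⧸ extendByKer ℍ Λ => ∫⁻ t in F ∩ genericPoints Γ,
    ‖weighted k f (r.out⁻¹ • t)‖ₑ] at h

theorem ae_summable_poincareTerm :
    ∀ᵐ z : ℍ, Summable fun q => ‖poincareTerm Λ χ k f z q‖ := by
  have hc := countable_of_discrete Γ
  obtain ⟨F, hF⟩ := exists_isTransversal_of_discrete Γ
  have : Countable (Quotient (QuotientGroup.rightRel Λ)) := Quotient.countable
  refine hF.ae_of_ae_restrict (fun σ z h => ?_) ?_
  · have hσ (q : Γ ⧸ Λ) : ‖twist χ k f q.out⁻¹ (σ • z)‖ = ‖(σ : Mp2).η z ^ (2 * k + 1 : ℤ)‖ *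
        ‖twist χ k f (MulAction.toPerm σ⁻¹ q).out⁻¹ z‖ := by
      rw [twist_smul, norm_mul, norm_mul, Circle.norm_coe, one_mul,
        apply_out_inv_mul (h := twist χ k f) fun l hl => twist_mul_left (hf1 l hl)]
    have h0 : ‖(σ : Mp2).η z ^ (2 * k + 1 : ℤ)‖ ≠ 0 :=
      norm_ne_zero_iff.2 (zpow_ne_zero _ (η_ne_zero _ _))
    have hΛ (w : ℍ) : (Summable fun q => ‖poincareTerm Λ χ k f w q‖) ↔
        Summable fun q : Γ ⧸ Λ => ‖twist χ k f q.out⁻¹ w‖ := by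
      rw [← (QuotientGroup.quotientRightRelEquivQuotientLeftRel Λ).summable_iff]
      exact summable_congr fun q => by rw [poincareTerm_eq hf1]; rfl
    rw [hΛ] at h ⊢
    simp only [hσ] at h
    rw [summable_mul_left_iff h0] at h
    exact (MulAction.toPerm (β := Γ ⧸ Λ) σ⁻¹).summable_iff.1 h
  · have hm : Measurable fun z : ℍ =>
        ∑' q, ‖poincareTerm Λ χ k f z q * ((z.im ^ (weight k / 2) : ℝ) : ℂ)‖ₑ := by
      refine Measurable.tsum fun q => Measurable.enorm ?_
      exact (measurable_twist (χ := χ) hf q.out).mul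
        (Complex.measurable_ofReal.comp (continuous_im.measurable.pow_const _))
    filter_upwards [ae_lt_top hm
      (setLIntegral_tsum_enorm_poincareTerm_lt_top hf1 hχ hf hf2 hF).ne] with z hz
    have hy : ‖((z.im ^ (weight k / 2) : ℝ) : ℂ)‖ ≠ 0 :=
      norm_ne_zero_iff.2 (Complex.ofReal_ne_zero.2 (Real.rpow_pos_of_pos z.im_pos _).ne')
    have h : Summable fun q =>
        ‖poincareTerm Λ χ k f z q * ((z.im ^ (weight k / 2) : ℝ) : ℂ)‖ := by
      simp only [← toReal_enorm]
      exact ENNReal.summable_toReal hz.ne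
    simp only [norm_mul] at h
    exact (summable_mul_right_iff hy).1 h

theorem orbitLIntegral_weighted_poincare_lt_top :
    orbitLIntegral Γ volume Set.univ (fun z => ‖weighted k (poincare Λ χ k f) z‖ₑ) < ∞ := by
  obtain ⟨F, hF⟩ := exists_isTransversal_of_discrete Γ
  rw [orbitLIntegral_weighted_poincare_eq hf1 hf hF]
  refine lt_of_le_of_lt (lintegral_mono fun z => ?_)
    (setLIntegral_tsum_enorm_poincareTerm_lt_top hf1 hχ hf hf2 hF)
  rw [weighted, poincare, ← tsum_mul_right]
  exact enorm_tsum_le_tsum_enorm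

/-- If the Poincaré series vanished almost everywhere, then on `S` the identity term would be
dominated by the sum of the others. Integrated over `S`, the identity term gives the integral over
`Λ\Λ.S`; the others, unfolded, give at most the integral over the complement. -/
theorem not_ae_poincare_eq_zero {S : Set ℍ} (hS : MeasurableSet S)
    (hS1 : ∀ z₁ ∈ S, ∀ z₂ ∈ S, z₁ ≠ z₂ → MulAction.orbit Γ z₁ ≠ MulAction.orbit Γ z₂)
    {N : ℂ → ℝ≥0} (hN : Measurable N) (hN1 : N 0 = 0)
    (hN2 : ∀ z : ℂ, N z = N ((‖z‖ : ℝ) : ℂ))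
    (hN3 : ∀ z : ℕ → ℂ, (Summable fun i => ‖z i‖) →
      (N (∑' i, z i) : ℝ≥0∞) ≤ ∑' i, (N (z i) : ℝ≥0∞))
    (hS2 : orbitLIntegral Λ volume (orbitSet Λ S) (fun z => (N (weighted k f z) : ℝ≥0∞))
      > orbitLIntegral Λ volume (orbitSet Λ S)ᶜ (fun z => (N (weighted k f z) : ℝ≥0∞))) :
    ¬ ∀ᵐ z : ℍ, poincare Λ χ k f z = 0 := by
  intro h0
  refine hS2.not_ge ?_
  have hc := countable_of_discrete Γ
  have : Countable (Γ ⧸ extendByKer ℍ Λ) := Quotient.countable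
  obtain ⟨FΛ, hFΛ⟩ := exists_isTransversal_subgroup Λ
  have hψ : Measurable fun z => (N (weighted k f z) : ℝ≥0∞) :=
    (hN.comp (measurable_weighted k hf)).coe_nnreal_ennreal
  have hψΛ (l : Λ) (z : ℍ) : (N (weighted k f (l • z)) : ℝ≥0∞) = N (weighted k f z) := by
    rw [hN2, norm_weighted_smul hf1, ← hN2]
  have hSeq : ∀ x ∈ S, ∀ y ∈ S, ∀ g : Γ, g • y = x → x = y := fun x hx y hy g hg => by
    by_contra hne
    exact hS1 x hx y hy hne (MulAction.orbit_eq_iff.2 ⟨g, hg⟩)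
  have hSΓ : Set.InjOn (orbitMk Γ) S := fun x hx y hy hxy => by
    obtain ⟨g, hg⟩ := (orbitMk_eq_iff Γ).1 hxy
    exact hSeq x hx y hy g hg
  have hSΛ : Set.InjOn (orbitMk Λ) S := fun x hx y hy hxy => by
    obtain ⟨l, hl⟩ := (orbitMk_eq_iff Λ).1 hxy
    exact hSeq x hx y hy l hl
  have hae : (S ∩ genericPoints Γ : Set ℍ) =ᵐ[volume] S :=
    inter_ae_eq_left_of_ae_eq_univ (Filter.eventuallyEq_univ.2 (ae_mem_genericPoints Γ))
  rw [hFΛ.orbitLIntegral_orbitSet_eq hS hSΛ hψ hψΛ, ← setLIntegral_congr hae]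
  calc ∫⁻ z in S ∩ genericPoints Γ, (N (weighted k f z) : ℝ≥0∞)
      ≤ ∫⁻ z in S ∩ genericPoints Γ,
        ∑' r : ({((1 : Γ) : Γ ⧸ extendByKer ℍ Λ)}ᶜ : Set (Γ ⧸ extendByKer ℍ Λ)),
          (N (weighted k f ((r : Γ ⧸ extendByKer ℍ Λ).out⁻¹ • z)) : ℝ≥0∞) := by
        refine lintegral_mono_ae (ae_restrict_of_ae ?_)
        filter_upwards [h0, ae_summable_poincareTerm hf1 hχ hf hf2] with z hz hs
        exact coe_apply_weighted_le_of_poincare_eq_zero hf1 hχ hN1 hN2 hN3 hs hz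
    _ = ∑' r : ({((1 : Γ) : Γ ⧸ extendByKer ℍ Λ)}ᶜ : Set (Γ ⧸ extendByKer ℍ Λ)),
        ∫⁻ z in S ∩ genericPoints Γ,
          (N (weighted k f ((r : Γ ⧸ extendByKer ℍ Λ).out⁻¹ • z)) : ℝ≥0∞) :=
        lintegral_tsum fun r => (hψ.comp (measurable_const_smul _)).aemeasurable
    _ ≤ _ := by
        refine hFΛ.tsum_setLIntegral_smul_le (hS.inter (measurableSet_genericPoints Γ))
          (hSΓ.mono Set.inter_subset_left) (fun t ht => ht.2) _ ?_
          (measurableSet_orbitSet hS).compl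
          (fun l x hx hx' => hx ((smul_mem_orbitSet_iff l).1 hx')) hψ hψΛ
        -- If `γ⁻¹ t = l s` with `s, t ∈ S`, then `s = t`, so `γ l` acts trivially.
        rintro r hr t ht ⟨l, s, hs, hl⟩
        have hl' : ((l : Γ) • s : ℍ) = r.out⁻¹ • t := hl
        have hst : (r.out * l : Γ) • s = t := by rw [mul_smul, hl', smul_inv_smul]
        obtain rfl := hSeq t ht.1 s hs _ hst
        have hk : (r.out * l : Γ) ∈ (MulAction.toPermHom Γ ℍ).ker := mem_ker_iff.2 (ht.2 _ hst)
        refine hr ?_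
        rw [Set.mem_singleton_iff, ← QuotientGroup.out_eq' r]
        refine QuotientGroup.eq.2 ?_
        have h : r.out⁻¹ * 1 = (l : Γ) * (r.out * l : Γ)⁻¹ := by group
        rw [h]
        exact mul_mem (Subgroup.mem_sup_left l.2) (Subgroup.mem_sup_right (inv_mem hk))
end

end Mp2

theorem mainTheorem2
    (Γ : Subgroup Mp2) (hΓ : DiscreteTopology Γ) (Λ : Subgroup Γ) (χ : Γ →* Circle) (k : ℕ)
    (f : ℍ → ℂ) (hf : Measurable f)
    (hf1 : ∀ l : Γ, l ∈ Λ → ∀ z : ℍ, Mp2.slash k f (l : Mp2) z = (χ l : ℂ) * f z)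
    (hf2 : orbitLIntegral Λ volume Set.univ (fun z => ‖Mp2.weighted k f z‖ₑ) < ∞)
    (hχ : ∀ δ : Γ, (δ : Mp2) ∈ Subgroup.center Mp2 → (χ δ : ℂ) = Mp2.chiK k (δ : Mp2))
    (S : Set ℍ) (hS : MeasurableSet S)
    (hS1 : ∀ z₁ ∈ S, ∀ z₂ ∈ S, z₁ ≠ z₂ → MulAction.orbit Γ z₁ ≠ MulAction.orbit Γ z₂)
    (N : ℂ → ℝ≥0) (hN : Measurable N)
    (hN1 : N 0 = 0)
    (hN2 : ∀ z : ℂ, N z = N ((‖z‖ : ℝ) : ℂ))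
    (hN3 : ∀ z : ℕ → ℂ, (Summable fun i => ‖z i‖) →
      (N (∑' i, z i) : ℝ≥0∞) ≤ ∑' i, (N (z i) : ℝ≥0∞))
    (hS2 : orbitLIntegral Λ volume (orbitSet Λ S) (fun z => (N (Mp2.weighted k f z) : ℝ≥0∞))
      > orbitLIntegral Λ volume (orbitSet Λ S)ᶜ (fun z => (N (Mp2.weighted k f z) : ℝ≥0∞))) :
    (∀ᵐ z : ℍ, Summable fun q => ‖Mp2.poincareTerm Λ χ k f z q‖) ∧
    0 < orbitLIntegral Γ volume Set.univ
      (fun z => ‖Mp2.weighted k (Mp2.poincare Λ χ k f) z‖ₑ) ∧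
    orbitLIntegral Γ volume Set.univ
      (fun z => ‖Mp2.weighted k (Mp2.poincare Λ χ k f) z‖ₑ) < ∞ ∧
    ¬ (∀ᵐ z : ℍ, Mp2.poincare Λ χ k f z = 0) := by
  have hsum := Mp2.ae_summable_poincareTerm hf1 hχ hf hf2
  have hne := Mp2.not_ae_poincare_eq_zero hf1 hχ hf hf2 hS hS1 hN hN1 hN2 hN3 hS2
  exact ⟨hsum, pos_iff_ne_zero.2 fun h =>
      hne (Mp2.ae_poincare_eq_zero_of_orbitLIntegral_eq_zero hf1 hf h),
    Mp2.orbitLIntegral_weighted_poincare_lt_top hf1 hχ hf hf2, hne⟩
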